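/- Vertex algebras are over $\mathbb C$, with underlying vector superspace, state–field correspondence $Y(a,z)=\sum_{n\in\mathbb Z}a_nz^{-n-1}$, vacuum $\mathbf 1$ and translation operator $T$. Ideals, subalgebras and submodules are understood to be graded by parity. A parity-homogeneous set, or a subspace spanned by one, $X\subset W$ *strongly generates* $W$ if the right-nested normally ordered monomials $:T^{j_1}(w_1)\cdots T^{j_s}(w_s):$ with $s,j_1,\dots,j_s\ge 0$ and $w_i\in X$ span $W$ (the empty monomial being $\mathbf 1$). Let $W$ be a conformal vertex algebra of central charge $c$: there is a Virasoro vector $L$ of weight $2$, $Y(L,z)=\sum_n L(n)z^{-n-2}$, with $L(-1)=T$, such that $L(0)$ is diagonalizable with eigenspace decomposition $W=\bigoplus_{n\in\frac12\mathbb Z_{\ge0}}W(n)$, $\dim W(n)<\infty$, $W(0)=\mathbb C\mathbf 1$. Assume that $W$ has a conjugate linear involution $\phi$ (a conjugate linear automorphism with $\phi^2=1$) with $\phi(L)=L$, that $W(\frac12)=0$, and that $\mathfrak a=W(1)$ consists of primary vectors. Then $\mathfrak a$ is a Lie superalgebra with bracket $[a,b]=a_0b$ and invariant supersymmetric form $\langle\cdot,\cdot\rangle$,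 $a_1b=\langle a,b\rangle\mathbf 1$. It acts on $W$ by $a\mapsto a_0$. Let $V(\mathfrak a)\subset W$ be the vertex subalgebra generated by $\mathfrak a$. Assume $\mathfrak a=\bigoplus_{i=0}^r\mathfrak a_i$ (direct sum of Lie superalgebras), $\mathfrak a_0$ an even abelian Lie algebra (possibly $0$) and $\mathfrak a_i$, $i\ge1$, a simple Lie algebra or a basic Lie superalgebra (simple, finite-dimensional, with reductive even part and a nonzero even invariant supersymmetric bilinear form). For $i\ge 1$ fix a nondegenerate even invariant supersymmetric form $\langle\cdot,\cdot\rangle_i$ on $\mathfrak a_i$, define $k_i$ by $\langle\cdot,\cdot\rangle=k_i\langle\cdot,\cdot\rangle_i$ on $\mathfrak a_i$, let $C_{\mathfrak a_i}=\sum_m x^mx_m$ be the Casimir element, where $\{x^m\}$, $\{x_m\}$ are homogeneous bases of $\mathfrak a_i$ with $\langle x_m,x^n\rangle_i=\delta_{mn}$, and let $2h_i^\vee$ be its eigenvalue on $\mathfrak a_i$; assume $k_i+h^\vee_i\ne0$. On $\mathfrak a_0$ fix a basis $\{a_m\}$ with $\langle a_m,a_n\rangle=0$ for $m\neq n$ and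 $\langle a_m,a_m\rangle\in\{0,1\}$, and put $C_{\mathfrak a_0}=\sum_{m:\langle a_m,a_m\rangle=1}a_m^2$; let $k_0=0$ if $\langle\cdot,\cdot\rangle$ vanishes on $\mathfrak a_0$, and $k_0=1$ otherwise. Set $$L^{\mathfrak a}=\tfrac12\sum_{m:\langle a_m,a_m\rangle=1}:a_ma_m:+\sum_{i\ge1}\frac1{2(k_i+h_i^\vee)}\sum_m:x^mx_m:$$ (the inner sum being over the bases of $\mathfrak a_i$), write $Y(L^{\mathfrak a},z)=\sum_nL^{\mathfrak a}(n)z^{-n-2}$, and define $c_{\mathfrak a}$ by $L^{\mathfrak a}(2)L^{\mathfrak a}=\frac12c_{\mathfrak a}\mathbf 1$. Let $S=\bigoplus_{i\in\mathcal J}S_i\subset W$, where each $S_i$ is an irreducible $\mathfrak a$-submodule of $W$ contained in $W(\Delta_i)$, be such that $\mathfrak a\cup\{L-L^{\mathfrak a}\}\cup\bigcup_{i\in\mathcal J} S_i$ strongly generates $W$ and $(L-L^{\mathfrak a})(2)X=0$ for all $X\in S\cap W(2)$. For $i\in\mathcal J$ let $c^{(i)}_j$ be the eigenvalue of $C_{\mathfrak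 a_j}$ on $S_i$ and $$C_i=\sum_{j\ge1}\frac{c^{(i)}_j}{2(k_j+h_j^\vee)}+(1-\delta_{k_0,0})\frac{c_0^{(i)}}{2k_0},$$ the last summand being read as $0$ if $k_0=0$. **Theorem.** Assume $c=c_{\mathfrak a}$. Let $I$ be the ideal of $W$ generated by $L-L^{\mathfrak a}$ and $\pi_I:W\to\overline W=W/I$ the quotient map. Let $\mathcal K\subset\mathcal J$ be minimal (for inclusion) among the subsets for which $\pi_I(\mathfrak a)\cup\bigcup_{i\in\mathcal K}\pi_I(S_i)$ strongly generates $\overline W$. Then $C_j=\Delta_j$ for all $j\in\mathcal K$. In particular, if $C_i\neq\Delta_i$ for all $i\in\mathcal J$, then every such $\mathcal K$ is empty, and $\overline W$ collapses to the image of $V(\mathfrak a)$: the natural map $V(\mathfrak a)/(I\cap V(\mathfrak a))\to\overline W$ is an isomorphism of vertex algebras. -/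

import Mathlib

noncomputable section

/-- The sign `p(a, b) = (-1)^{p(a) p(b)}` for elements of parities `p`, `q`. -/
def parSign (p q : ZMod 2) : ℂ := if p = 1 ∧ q = 1 then -1 else 1

/-- The coefficient `binom(m, j)` for an arbitrary integer `m`, as a complex number. -/
def binomC (m : ℤ) (j : ℕ) : ℂ := ((Ring.choose m j : ℤ) : ℂ)

/-- A vertex algebra (with underlying vector superspace `W = par 0 ⊕ par 1`) over `ℂ`, given by
its `n`-th products `nprod n a b = a_n b`, where `Y(a, z) = ∑ a_n z^{-n-1}`, the vacuum vector and
the Borcherds identity.  The sums in the identity are finite by `truncation`. -/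
structure VertexSuperalgebra (W : Type*) [AddCommGroup W] [Module ℂ W] where
  /-- even (`par 0`) and odd (`par 1`) part -/
  par : ZMod 2 → Submodule ℂ W
  par_isCompl : IsCompl (par 0) (par 1)
  /-- the `n`-th product `a_n b` -/
  nprod : ℤ → W →ₗ[ℂ] W →ₗ[ℂ] W
  /-- the vacuum vector -/
  vac : W
  vac_even : vac ∈ par 0
  nprod_mem : ∀ {p q : ZMod 2} (n : ℤ) {a b : W},
    a ∈ par p → b ∈ par q → nprod n a b ∈ par (p + q)
  truncation : ∀ a b : W, ∃ N : ℤ, ∀ n : ℤ, N ≤ n → nprod n a b = 0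
  vac_nprod : ∀ (n : ℤ) (b : W), nprod n vac b = if n = -1 then b else 0
  nprod_vac : ∀ a : W, nprod (-1) a vac = a
  nprod_vac_of_nonneg : ∀ (a : W) (n : ℤ), 0 ≤ n → nprod n a vac = 0
  borcherds : ∀ {p q : ZMod 2} {a b : W} (c : W), a ∈ par p → b ∈ par q → ∀ m n k : ℤ,
    ∑ᶠ j : ℕ, binomC m j • nprod (m + k - j) (nprod (n + j) a b) c =
    ∑ᶠ j : ℕ, ((-1 : ℂ) ^ j * binomC n j) •
      (nprod (m + n - j) a (nprod (k + j) b c) -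
        (parSign p q * (-1 : ℂ) ^ n) • nprod (n + k - j) b (nprod (m + j) a c))

namespace VertexSuperalgebra

variable {W : Type*} [AddCommGroup W] [Module ℂ W] (V : VertexSuperalgebra W)

/-- The translation operator `T a = a_{-2} 1`. -/
def T : Module.End ℂ W := (V.nprod (-2)).flip V.vac

/-- A subspace is graded (homogeneous with respect to parity) if it contains the even and the odd
component of each of its elements. -/
def IsGraded (N : Submodule ℂ W) : Prop :=
  ∀ x ∈ V.par 0, ∀ y ∈ V.par 1, x + y ∈ N → x ∈ N ∧ y ∈ N

/-- The normally ordered monomial `:T^{j₁}(w₁) ⋯ T^{jᵣ}(wᵣ):` attached to a list of pairs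
`(jᵢ, wᵢ)`, nested from the right; the empty monomial is the vacuum. -/
def monomial : List (ℕ × W) → W
  | [] => V.vac
  | x :: l => V.nprod (-1) ((V.T ^ x.1) x.2) (monomial l)

/-- `X` strongly generates the vertex algebra: the normally ordered monomials in derivatives of
elements of `X` span. -/
def StronglyGenerates (X : Set W) : Prop :=
  Submodule.span ℂ {w : W | ∃ l : List (ℕ × W), (∀ x ∈ l, x.2 ∈ X) ∧ V.monomial l = w} = ⊤

/-- A (two-sided, graded) ideal of a vertex algebra. Stability under `T` is automatic, since
`T w = w_{-2} 1`. -/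
structure IsIdeal (I : Submodule ℂ W) : Prop where
  graded : V.IsGraded I
  left : ∀ (n : ℤ) (a : W), ∀ w ∈ I, V.nprod n a w ∈ I
  right : ∀ (n : ℤ) (a : W), ∀ w ∈ I, V.nprod n w a ∈ I

/-- A (graded) vertex subalgebra. Stability under `T` is automatic, since `T w = w_{-2} 1`. -/
structure IsSubalgebra (U : Submodule ℂ W) : Prop where
  graded : V.IsGraded U
  vac_mem : V.vac ∈ U
  nprod_mem : ∀ n : ℤ, ∀ a ∈ U, ∀ b ∈ U, V.nprod n a b ∈ U

/-- The ideal generated by a set. -/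
def idealSpan (X : Set W) : Submodule ℂ W := sInf {I | V.IsIdeal I ∧ X ⊆ I}

/-- The vertex subalgebra generated by a set. -/
def adjoin (X : Set W) : Submodule ℂ W := sInf {U | V.IsSubalgebra U ∧ X ⊆ U}

theorem isIdeal_idealSpan (X : Set W) : V.IsIdeal (V.idealSpan X) where
  graded x hx y hy h := by
    simp only [idealSpan, Submodule.mem_sInf, Set.mem_ofPred_eq] at h ⊢
    exact ⟨fun I hI => (hI.1.graded x hx y hy (h I hI)).1,
      fun I hI => (hI.1.graded x hx y hy (h I hI)).2⟩
  left n a w h := by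
    simp only [idealSpan, Submodule.mem_sInf, Set.mem_ofPred_eq] at h ⊢
    exact fun I hI => hI.1.left n a w (h I hI)
  right n a w h := by
    simp only [idealSpan, Submodule.mem_sInf, Set.mem_ofPred_eq] at h ⊢
    exact fun I hI => hI.1.right n a w (h I hI)

theorem isSubalgebra_adjoin (X : Set W) : V.IsSubalgebra (V.adjoin X) where
  graded x hx y hy h := by
    simp only [adjoin, Submodule.mem_sInf, Set.mem_ofPred_eq] at h ⊢
    exact ⟨fun I hI => (hI.1.graded x hx y hy (h I hI)).1,
      fun I hI => (hI.1.graded x hx y hy (h I hI)).2⟩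
  vac_mem := by
    simp only [adjoin, Submodule.mem_sInf, Set.mem_ofPred_eq]
    exact fun I hI => hI.1.vac_mem
  nprod_mem n a ha b hb := by
    simp only [adjoin, Submodule.mem_sInf, Set.mem_ofPred_eq] at ha hb ⊢
    exact fun I hI => hI.1.nprod_mem n a (ha I hI) b (hb I hI)

theorem finite_left (a b c : W) (m n k : ℤ) :
    (Function.support fun j : ℕ =>
      binomC m j • V.nprod (m + k - j) (V.nprod (n + j) a b) c).Finite := by
  obtain ⟨N, hN⟩ := V.truncation a b
  refine (Set.finite_lt_nat (N - n).toNat).subset fun j hj => ?_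
  by_contra hlt
  simp only [Set.mem_ofPred_eq, not_lt] at hlt
  exact hj (by simp [hN (n + j) (by omega)])

theorem finite_right (a b c : W) (m n k : ℤ) (s : ℂ) :
    (Function.support fun j : ℕ => ((-1 : ℂ) ^ j * binomC n j) •
      (V.nprod (m + n - j) a (V.nprod (k + j) b c) -
        s • V.nprod (n + k - j) b (V.nprod (m + j) a c))).Finite := by
  obtain ⟨N, hN⟩ := V.truncation b c
  obtain ⟨M, hM⟩ := V.truncation a c
  refine (Set.finite_lt_nat (max (N - k).toNat (M - m).toNat)).subset fun j hj => ?_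
  by_contra hlt
  simp only [Set.mem_ofPred_eq, not_lt] at hlt
  exact hj (by simp [hN (k + j) (by omega), hM (m + j) (by omega)])

/-- The products induced on the quotient by an ideal. -/
def quotientNprod {I : Submodule ℂ W} (hI : V.IsIdeal I) (n : ℤ) :
    (W ⧸ I) →ₗ[ℂ] (W ⧸ I) →ₗ[ℂ] (W ⧸ I) :=
  I.liftQ
    { toFun := fun a => I.mapQ I (V.nprod n a) fun w hw => hI.left n a w hw
      map_add' := fun a b => by
        refine Submodule.linearMap_qext _ (LinearMap.ext fun w => ?_)
        simp
      map_smul' := fun r a => by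
        refine Submodule.linearMap_qext _ (LinearMap.ext fun w => ?_)
        simp }
    fun a ha => by
      refine LinearMap.mem_ker.2 (Submodule.linearMap_qext _ (LinearMap.ext fun w => ?_))
      simpa using hI.right n w a ha

@[simp]
theorem quotientNprod_mk {I : Submodule ℂ W} (hI : V.IsIdeal I) (n : ℤ) (a b : W) :
    V.quotientNprod hI n (I.mkQ a) (I.mkQ b) = I.mkQ (V.nprod n a b) := rfl

/-- The quotient vertex algebra `W / I`. -/
def quotient {I : Submodule ℂ W} (hI : V.IsIdeal I) : VertexSuperalgebra (W ⧸ I) where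
  par p := (V.par p).map I.mkQ
  par_isCompl := by
    constructor
    · rw [Submodule.disjoint_def]
      rintro _ ⟨x, hx, rfl⟩ ⟨y, hy, hxy⟩
      have h : x - y ∈ I := (Submodule.Quotient.eq I).1 hxy.symm
      rw [sub_eq_add_neg] at h
      exact (Submodule.Quotient.mk_eq_zero I).2
        (hI.graded x hx (-y) (Submodule.neg_mem _ hy) h).1
    · rw [codisjoint_iff, ← Submodule.map_sup, V.par_isCompl.sup_eq_top, Submodule.map_top,
        Submodule.range_mkQ]
  nprod := V.quotientNprod hI
  vac := I.mkQ V.vac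
  vac_even := ⟨_, V.vac_even, rfl⟩
  nprod_mem := by
    rintro p q n _ _ ⟨a, ha, rfl⟩ ⟨b, hb, rfl⟩
    exact ⟨_, V.nprod_mem n ha hb, rfl⟩
  truncation a b := by
    obtain ⟨a, rfl⟩ := I.mkQ_surjective a
    obtain ⟨b, rfl⟩ := I.mkQ_surjective b
    obtain ⟨N, hN⟩ := V.truncation a b
    exact ⟨N, fun n hn => by rw [quotientNprod_mk, hN n hn, map_zero]⟩
  vac_nprod n b := by
    obtain ⟨b, rfl⟩ := I.mkQ_surjective b
    rw [quotientNprod_mk, V.vac_nprod]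
    split_ifs <;> simp
  nprod_vac a := by
    obtain ⟨a, rfl⟩ := I.mkQ_surjective a
    rw [quotientNprod_mk, V.nprod_vac]
  nprod_vac_of_nonneg a n hn := by
    obtain ⟨a, rfl⟩ := I.mkQ_surjective a
    rw [quotientNprod_mk, V.nprod_vac_of_nonneg a n hn, map_zero]
  borcherds := by
    rintro p q _ _ c ⟨a, ha, rfl⟩ ⟨b, hb, rfl⟩ m n k
    obtain ⟨c, rfl⟩ := I.mkQ_surjective c
    have h := congrArg I.mkQ (V.borcherds c ha hb m n k)
    rw [map_finsum I.mkQ (V.finite_left a b c m n k),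
      map_finsum I.mkQ (V.finite_right a b c m n k _)] at h
    simpa only [map_smul, map_sub, quotientNprod_mk] using h

/-- A vertex subalgebra, as a vertex algebra. -/
def restrict {U : Submodule ℂ W} (hU : V.IsSubalgebra U) : VertexSuperalgebra U where
  par p := (V.par p).comap U.subtype
  par_isCompl := by
    constructor
    · rw [Submodule.disjoint_def]
      intro x hx hy
      exact Subtype.ext (Submodule.disjoint_def.1 V.par_isCompl.disjoint x hx hy)
    · rw [codisjoint_iff, Submodule.eq_top_iff']
      intro z
      obtain ⟨x, hx, y, hy, hxy⟩ := Submodule.mem_sup.1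
        (V.par_isCompl.sup_eq_top ▸ Submodule.mem_top : (z : W) ∈ V.par 0 ⊔ V.par 1)
      have h := hU.graded x hx y hy (hxy ▸ z.2)
      exact Submodule.mem_sup.2 ⟨⟨x, h.1⟩, hx, ⟨y, h.2⟩, hy, Subtype.ext hxy⟩
  nprod n := LinearMap.mk₂ ℂ (fun a b => ⟨V.nprod n a b, hU.nprod_mem n a a.2 b b.2⟩)
    (fun _ _ _ => Subtype.ext (by simp)) (fun _ _ _ => Subtype.ext (by simp))
    (fun _ _ _ => Subtype.ext (by simp)) (fun _ _ _ => Subtype.ext (by simp))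
  vac := ⟨V.vac, hU.vac_mem⟩
  vac_even := V.vac_even
  nprod_mem := fun n _ _ ha hb => V.nprod_mem n (Submodule.mem_comap.1 ha) (Submodule.mem_comap.1 hb)
  truncation a b := by
    obtain ⟨N, hN⟩ := V.truncation a b
    exact ⟨N, fun n hn => Subtype.ext (hN n hn)⟩
  vac_nprod n b := Subtype.ext (by
    simp only [LinearMap.mk₂_apply, V.vac_nprod]
    split_ifs <;> rfl)
  nprod_vac a := Subtype.ext (V.nprod_vac a)
  nprod_vac_of_nonneg a n hn := Subtype.ext (V.nprod_vac_of_nonneg a n hn)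
  borcherds := by
    intro p q a b c ha hb m n k
    refine Subtype.ext ?_
    change U.subtype _ = U.subtype _
    rw [map_finsum U.subtype, map_finsum U.subtype]
    · simpa using V.borcherds (c : W) ha hb m n k
    · refine (V.finite_right a b c m n k (parSign p q * (-1 : ℂ) ^ n)).subset fun j hj h0 => hj ?_
      exact Subtype.ext (by simpa using h0)
    · refine (V.finite_left a b c m n k).subset fun j hj h0 => hj ?_
      exact Subtype.ext (by simpa using h0)

theorem IsIdeal.comap_subtype {V : VertexSuperalgebra W} {I U : Submodule ℂ W}
    (hI : V.IsIdeal I) (hU : V.IsSubalgebra U) :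
    (V.restrict hU).IsIdeal (I.comap U.subtype) where
  graded x hx y hy h :=
    hI.graded (x : W) (Submodule.mem_comap.1 hx) (y : W) (Submodule.mem_comap.1 hy) h
  left n a w hw := hI.left n (a : W) (w : W) hw
  right n a w hw := hI.right n (a : W) (w : W) hw

/-- A linear equivalence is an isomorphism of vertex algebras if it preserves the parity, the
vacuum vector and all products. -/
structure IsIso {W' : Type*} [AddCommGroup W'] [Module ℂ W'] (V : VertexSuperalgebra W)
    (V' : VertexSuperalgebra W') (e : W ≃ₗ[ℂ] W') : Prop where
  par : ∀ p, ∀ a ∈ V.par p, e a ∈ V'.par p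
  vac : e V.vac = V'.vac
  nprod : ∀ n a b, e (V.nprod n a b) = V'.nprod n (e a) (e b)

/-- A conjugate linear involution: a conjugate linear automorphism of the vertex algebra whose
square is the identity. -/
structure IsConjInvolution (φ : W →ₛₗ[starRingEnd ℂ] W) : Prop where
  par : ∀ p, ∀ a ∈ V.par p, φ a ∈ V.par p
  vac : φ V.vac = V.vac
  nprod : ∀ n a b, φ (V.nprod n a b) = V.nprod n (φ a) (φ b)
  involutive : ∀ a, φ (φ a) = a

/-- The bilinear form `β` on `g` is even, supersymmetric, and invariant for `[x, y] = x_0 y`. -/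
structure IsInvariantForm (g : Submodule ℂ W) (β : LinearMap.BilinForm ℂ g) : Prop where
  even : ∀ x y : g, (x : W) ∈ V.par 0 → (y : W) ∈ V.par 1 → β x y = 0
  supersymm : ∀ p q : ZMod 2, ∀ x y : g, (x : W) ∈ V.par p → (y : W) ∈ V.par q →
    β y x = parSign p q * β x y
  invariant : ∀ x y z u v : g, (u : W) = V.nprod 0 (x : W) y → (v : W) = V.nprod 0 (y : W) z →
    β u z = β x v

/-- A basic Lie superalgebra inside `W`, with the bracket `[x, y] = x_0 y`: a graded subspace,
closed under the bracket and finite-dimensional, which is simple (not abelian, no graded ideals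
except `0` and itself), whose even part is reductive (each of its ideals has a complementary
ideal), and which has a nonzero even invariant supersymmetric bilinear form.  Finite-dimensional
simple Lie algebras are the purely even case. -/
structure IsBasic (g : Submodule ℂ W) : Prop where
  graded : V.IsGraded g
  finite : FiniteDimensional ℂ g
  bracket_mem : ∀ x ∈ g, ∀ y ∈ g, V.nprod 0 x y ∈ g
  not_abelian : ∃ x ∈ g, ∃ y ∈ g, V.nprod 0 x y ≠ 0
  simple : ∀ N ≤ g, V.IsGraded N → (∀ x ∈ g, ∀ y ∈ N, V.nprod 0 x y ∈ N) → N = ⊥ ∨ N = g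
  even_reductive : ∀ N ≤ g ⊓ V.par 0, (∀ x ∈ g ⊓ V.par 0, ∀ y ∈ N, V.nprod 0 x y ∈ N) →
    ∃ N' ≤ g ⊓ V.par 0, (∀ x ∈ g ⊓ V.par 0, ∀ y ∈ N', V.nprod 0 x y ∈ N') ∧
      N ⊓ N' = ⊥ ∧ N ⊔ N' = g ⊓ V.par 0
  exists_form : ∃ β : LinearMap.BilinForm ℂ g, V.IsInvariantForm g β ∧ β ≠ 0

end VertexSuperalgebra

/-- The scalar by which an endomorphism acts on a subspace (when it acts by a scalar). -/
def scalarOn {W : Type*} [AddCommGroup W] [Module ℂ W] (f : Module.End ℂ W)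
    (S : Submodule ℂ W) : ℂ :=
  Classical.epsilon fun c : ℂ => ∀ v ∈ S, f v = c • v

/-- A conformal vertex algebra of central charge `c`, with Virasoro vector `L`; its modes are
`L(n) = L_{n+1}`.  The operator `L(0)` is diagonalizable with eigenvalues in `{0, 1/2, 1, …}`,
finite-dimensional eigenspaces, and `0`-eigenspace `ℂ 1`. -/
structure ConformalVertexAlgebra (W : Type*) [AddCommGroup W] [Module ℂ W] extends
    VertexSuperalgebra W where
  L : W
  c : ℂ
  L_even : L ∈ par 0
  L_weight : nprod 1 L L = (2 : ℂ) • L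
  virasoro : ∀ (m n : ℤ) (w : W),
    nprod (m + 1) L (nprod (n + 1) L w) - nprod (n + 1) L (nprod (m + 1) L w) =
      ((m : ℂ) - n) • nprod (m + n + 1) L w +
        (if m + n = 0 then ((m : ℂ) ^ 3 - m) / 12 * c else 0) • w
  L_neg_one : ∀ w : W, nprod 0 L w = nprod (-2) w vac
  iSup_eigenspace : ⨆ n : ℕ, Module.End.eigenspace (nprod 1 L) ((n : ℂ) / 2) = ⊤
  finite_eigenspace : ∀ n : ℕ,
    FiniteDimensional ℂ (Module.End.eigenspace (nprod 1 L) ((n : ℂ) / 2))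
  eigenspace_zero : Module.End.eigenspace (nprod 1 L) 0 = Submodule.span ℂ {vac}

namespace ConformalVertexAlgebra

variable {W : Type*} [AddCommGroup W] [Module ℂ W] (V : ConformalVertexAlgebra W)

/-- The space `W(d)` of vectors of conformal weight `d`. -/
def weightSpace (d : ℂ) : Submodule ℂ W := Module.End.eigenspace (V.nprod 1 V.L) d

/-- `a` is primary: `L(n) a = 0` for `n ≥ 1`, and `a` is homogeneous for `L(0)`. -/
def IsPrimary (a : W) : Prop :=
  (∃ d : ℂ, a ∈ V.weightSpace d) ∧ ∀ n : ℤ, 1 ≤ n → V.nprod (n + 1) V.L a = 0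

/-- `S` is an irreducible module over the Lie superalgebra `𝔞 = W(1)`, acting by `a ↦ a_0`. -/
structure IsIrreducible (S : Submodule ℂ W) : Prop where
  ne_bot : S ≠ ⊥
  graded : V.IsGraded S
  stable : ∀ a ∈ V.weightSpace 1, ∀ v ∈ S, V.nprod 0 a v ∈ S
  eq_bot_or_eq : ∀ N ≤ S, V.IsGraded N →
    (∀ a ∈ V.weightSpace 1, ∀ v ∈ N, V.nprod 0 a v ∈ N) → N = ⊥ ∨ N = S

/-- A decomposition `𝔞 = 𝔞₀ ⊕ 𝔞₁ ⊕ ⋯ ⊕ 𝔞ᵣ` of the Lie superalgebra `𝔞 = W(1)`, where `𝔞₀` is even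
abelian and `𝔞₁, …, 𝔞ᵣ` are basic (simple Lie algebras being included), with the choices
that enter the definition of the Casimir elements:
a nondegenerate even invariant supersymmetric form and a homogeneous basis on each of
`𝔞₁, …, 𝔞ᵣ`, and on `𝔞₀` a basis `(aₘ)` with `⟨aₘ, aₙ⟩ = 0` for `m ≠ n` and `⟨aₘ, aₘ⟩ = 1` for
`m ∈ nondeg`, `⟨aₘ, aₘ⟩ = 0` for `m ∉ nondeg`.
Here `⟨a, b⟩` is the form on `𝔞` with `a_1 b = ⟨a, b⟩ 1`. -/
structure AffineDecomposition (r : ℕ) where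
  comp : Fin (r + 1) → Submodule ℂ W
  indep : iSupIndep comp
  iSup_comp : ⨆ i, comp i = V.weightSpace 1
  commute : ∀ i j, i ≠ j → ∀ x ∈ comp i, ∀ y ∈ comp j, V.nprod 0 x y = 0
  zero_even : comp 0 ≤ V.par 0
  zero_abelian : ∀ x ∈ comp 0, ∀ y ∈ comp 0, V.nprod 0 x y = 0
  basic : ∀ i : Fin r, V.IsBasic (comp i.succ)
  form : ∀ i : Fin r, LinearMap.BilinForm ℂ (comp i.succ)
  form_invariant : ∀ i, V.IsInvariantForm (comp i.succ) (form i)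
  form_nondeg : ∀ i, (form i).Nondegenerate
  dim : Fin r → ℕ
  basis : ∀ i, Module.Basis (Fin (dim i)) ℂ (comp i.succ)
  basis_homogeneous : ∀ i m, ∃ p, (basis i m : W) ∈ V.par p
  dim₀ : ℕ
  basis₀ : Module.Basis (Fin dim₀) ℂ (comp 0)
  nondeg : Finset (Fin dim₀)
  basis₀_form : ∀ m n, V.nprod 1 (basis₀ m : W) (basis₀ n) =
    if m = n ∧ m ∈ nondeg then V.vac else 0

namespace AffineDecomposition

variable {V} {r : ℕ} (D : V.AffineDecomposition r)

/-- The basis `(xₘ)` of `𝔞ᵢ` dual to the chosen basis `(xᵐ)`: `⟨xₘ, xⁿ⟩ᵢ = δₘₙ`. -/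
def dual (i : Fin r) : Module.Basis (Fin (D.dim i)) ℂ (D.comp i.succ) :=
  LinearMap.BilinForm.dualBasis (D.form i) (D.form_nondeg i) (D.basis i)

/-- The action on `W` of the Casimir element `∑ xᵐ xₘ` of `𝔞ᵢ`, `i ≥ 1`. -/
def casimir (i : Fin r) : Module.End ℂ W :=
  ∑ m, (V.nprod 0 (D.basis i m : W)) ∘ₗ (V.nprod 0 (D.dual i m : W))

/-- The action on `W` of the Casimir element `∑ aₘ²` (sum over `m ∈ nondeg`) of `𝔞₀`. -/
def casimir₀ : Module.End ℂ W :=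
  ∑ m ∈ D.nondeg, (V.nprod 0 (D.basis₀ m : W)) ∘ₗ (V.nprod 0 (D.basis₀ m : W))

/-- The number `hᵢ^∨`: half the eigenvalue of the Casimir element of `𝔞ᵢ` on `𝔞ᵢ`. -/
def dualCoxeter (i : Fin r) : ℂ := scalarOn (D.casimir i) (D.comp i.succ) / 2

/-- The level `kᵢ`, `i ≥ 1`, defined by `⟨x, y⟩ = kᵢ ⟨x, y⟩ᵢ` on `𝔞ᵢ`. -/
def level (i : Fin r) : ℂ :=
  Classical.epsilon fun k : ℂ => ∀ x y : D.comp i.succ,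
    V.nprod 1 (x : W) y = (k * D.form i x y) • V.vac

open Classical in
/-- `k₀ = 0` if the form `⟨ , ⟩` vanishes on `𝔞₀`, and `k₀ = 1` otherwise. -/
def level₀ (D : V.AffineDecomposition r) : ℂ :=
  if ∀ x ∈ D.comp 0, ∀ y ∈ D.comp 0, V.nprod 1 x y = 0 then 0 else 1

/-- The vector `L^𝔞 = ½ ∑ :aₘ aₘ: + ∑ᵢ (2 (kᵢ + hᵢ^∨))⁻¹ ∑ₘ :xᵐ xₘ:`. -/
def sugawara : W :=
  (1 / 2 : ℂ) • ∑ m ∈ D.nondeg, V.nprod (-1) (D.basis₀ m : W) (D.basis₀ m) +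
  ∑ i, (1 / (2 * (D.level i + D.dualCoxeter i))) •
    ∑ m, V.nprod (-1) (D.basis i m : W) (D.dual i m)

/-- The central charge `c_𝔞` of `L^𝔞`: `L^𝔞(2) L^𝔞 = ½ c_𝔞 1`, where `L^𝔞(2) = (L^𝔞)_3`. -/
def centralCharge : ℂ :=
  Classical.epsilon fun c : ℂ => V.nprod 3 D.sugawara D.sugawara = (c / 2) • V.vac

/-- The number attached to an irreducible `𝔞`-module `S`:
`∑_{j ≥ 1} c_j / (2 (kⱼ + hⱼ^∨)) + (1 - δ_{k₀,0}) c₀ / (2 k₀)`, where `c_j` is the eigenvalue of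
the Casimir element of `𝔞ⱼ` on `S`. -/
def casimirWeight (S : Submodule ℂ W) : ℂ :=
  ∑ j, scalarOn (D.casimir j) S / (2 * (D.level j + D.dualCoxeter j)) +
    (if D.level₀ = 0 then 0 else scalarOn D.casimir₀ S / (2 * D.level₀))

/-- The ideal `I` generated by `L - L^𝔞`. -/
def ideal : Submodule ℂ W := V.idealSpan {V.L - D.sugawara}

theorem isIdeal_ideal : V.IsIdeal D.ideal := V.isIdeal_idealSpan _

/-- The quotient vertex algebra `W / I`. -/
def quotient : VertexSuperalgebra (W ⧸ D.ideal) :=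
  V.toVertexSuperalgebra.quotient D.isIdeal_ideal

/-- For a family `S` of subspaces and a set `K` of indices: `𝔞` together with the `S i`, `i ∈ K`,
has an image in `W / I` which strongly generates `W / I`. -/
def QuotientGeneratedBy {J : Type*} (S : J → Submodule ℂ W) (K : Set J) : Prop :=
  D.quotient.StronglyGenerates
    (D.ideal.mkQ '' ((V.weightSpace 1 : Set W) ∪ ⋃ i ∈ K, (S i : Set W)))

end AffineDecomposition

/-- The vertex subalgebra `V(𝔞)` of `W` generated by `𝔞 = W(1)`. -/
def affineSubalgebra : Submodule ℂ W := V.adjoin (V.weightSpace 1 : Set W)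

theorem isSubalgebra_affineSubalgebra : V.IsSubalgebra V.affineSubalgebra :=
  V.isSubalgebra_adjoin _

/-- The vertex algebra `V(𝔞) / (I ∩ V(𝔞))`. -/
def AffineDecomposition.affineQuotient {V : ConformalVertexAlgebra W} {r : ℕ}
    (D : V.AffineDecomposition r) :
    VertexSuperalgebra (V.affineSubalgebra ⧸ D.ideal.comap V.affineSubalgebra.subtype) :=
  (V.toVertexSuperalgebra.restrict V.isSubalgebra_affineSubalgebra).quotient
    (D.isIdeal_ideal.comap_subtype V.isSubalgebra_affineSubalgebra)

end ConformalVertexAlgebra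

end

/-! In `W / I` the vectors `L` and `L^𝔞` coincide, so their weight-preserving modes `L(0)` and
`L^𝔞(0)` act in the same way. Let `w ∈ S i`. Then `L(0) w = Δᵢ w`. Expanding the modes of the
products `:ab:` shows that `L^𝔞(0) w` is `Cᵢ w` plus vectors `a_{-1-n} v` with `a ∈ 𝔞`, `n ≥ 0` and
`v` of weight `Δᵢ - n - 1`. Hence `(Δᵢ - Cᵢ) w` is, modulo `I`, a combination of such vectors
(`mkQ_mem_map_currentDescendants`). If `Cᵢ ≠ Δᵢ`, so is `w` itself. By induction on the weight every
`v` is already expressed through the remaining generators, and `S i` is superfluous. This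
contradicts minimality when `i ∈ K`. If it happens for all `i`, all the `S i` can be dropped at
once, and `𝔞` alone generates the quotient.

Two points need work. The first is that the Casimir elements act on `S i` by scalars: they commute
with `𝔞` by invariance of the forms (`casimir_comm`), and Schur's lemma applies
(`IsIrreducible.exists_scalar`). The second is that a generator which is a combination of monomials
in other generators can be discarded. Substituting it into a right-nested monomial destroys the
nesting, and `GradedMonomial.nprod_mem_monomialSpan` restores it by the Borcherds identity and
induction.

Weights are doubled to make them integers: `G n` has weight `n / 2`, so that `𝔞` is `G 2`. -/

noncomputable section
-- Consequences of the Borcherds identity: commutators, associators, translation, skew-symmetry.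
namespace VertexSuperalgebra

variable {W : Type*} [AddCommGroup W] [Module ℂ W] (V : VertexSuperalgebra W)

@[simp]
theorem parSign_zero_left (q : ZMod 2) : parSign 0 q = 1 := by simp [parSign]

@[simp]
theorem parSign_zero_right (p : ZMod 2) : parSign p 0 = 1 := by simp [parSign]

@[simp]
theorem parSign_mul_self (p q : ZMod 2) : parSign p q * parSign p q = 1 := by
  unfold parSign; split_ifs <;> simp

@[simp]
theorem binomC_zero_right (m : ℤ) : binomC m 0 = 1 := by simp [binomC]

@[simp]
theorem binomC_one_right (m : ℤ) : binomC m 1 = m := by simp [binomC]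

theorem binomC_zero_left {j : ℕ} (hj : j ≠ 0) : binomC 0 j = 0 := by
  simp [binomC, Ring.choose_zero_pos ℤ (Nat.pos_of_ne_zero hj)]

theorem binomC_natCast (n j : ℕ) : binomC (n : ℤ) j = n.choose j := by
  simp [binomC, Ring.choose_natCast]

theorem neg_one_pow_mul_binomC_neg (r j : ℕ) :
    (-1 : ℂ) ^ j * binomC (-(r + 1 : ℕ)) j = (r + j).choose j := by
  rw [binomC, Ring.choose_neg,
    show ((r + 1 : ℕ) : ℤ) + j - 1 = ((r + j : ℕ) : ℤ) by push_cast; ring,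
    Ring.choose_natCast, Int.negOnePow_def, zpow_natCast, Units.smul_def]
  push_cast
  rw [smul_eq_mul, Int.cast_mul]
  push_cast
  rw [← mul_assoc, ← mul_pow]
  simp

theorem binomC_neg_one (j : ℕ) : (-1 : ℂ) ^ j * binomC (-1) j = 1 := by
  simpa using neg_one_pow_mul_binomC_neg 0 j

theorem binomC_neg_two (j : ℕ) : (-1 : ℂ) ^ j * binomC (-2) j = j + 1 := by
  have h := neg_one_pow_mul_binomC_neg 1 j
  rw [add_comm 1 j, Nat.choose_succ_self_right] at h
  simpa using h

theorem exists_parity (w : W) : ∃ x ∈ V.par 0, ∃ y ∈ V.par 1, x + y = w :=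
  Submodule.mem_sup.1 (V.par_isCompl.sup_eq_top ▸ Submodule.mem_top)

theorem parity_induction {P : W → Prop} (hadd : ∀ x y, P x → P y → P (x + y))
    (hpar : ∀ p, ∀ x ∈ V.par p, P x) (w : W) : P w := by
  obtain ⟨x, hx, y, hy, rfl⟩ := V.exists_parity w
  exact hadd _ _ (hpar _ _ hx) (hpar _ _ hy)

theorem commutator {p q : ZMod 2} {a b : W} (ha : a ∈ V.par p) (hb : b ∈ V.par q) (c : W)
    (m k : ℤ) :
    ∑ᶠ j : ℕ, binomC m j • V.nprod (m + k - j) (V.nprod j a b) c =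
      V.nprod m a (V.nprod k b c) - parSign p q • V.nprod k b (V.nprod m a c) := by
  have h := V.borcherds c ha hb m 0 k
  rw [finsum_eq_single (fun j : ℕ => ((-1 : ℂ) ^ j * binomC 0 j) • _) 0
    (fun j hj => by simp [binomC_zero_left hj])] at h
  simpa using h

theorem zero_mode_commutator {p q : ZMod 2} {a b : W} (ha : a ∈ V.par p) (hb : b ∈ V.par q)
    (c : W) (k : ℤ) :
    V.nprod 0 a (V.nprod k b c) =
      V.nprod k (V.nprod 0 a b) c + parSign p q • V.nprod k b (V.nprod 0 a c) := by
  have h := V.commutator ha hb c 0 k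
  rw [finsum_eq_single _ 0 (fun j hj => by simp [binomC_zero_left hj])] at h
  rw [← sub_eq_iff_eq_add, ← h]
  simp

theorem one_mode_commutator {a : W} (ha : a ∈ V.par 0) (b : W)
    (c : W) (k : ℤ) :
    V.nprod 1 a (V.nprod k b c) =
      V.nprod (k + 1) (V.nprod 0 a b) c + V.nprod k (V.nprod 1 a b) c +
        V.nprod k b (V.nprod 1 a c) := by
  induction b using V.parity_induction with
  | hadd x y hx hy => simp only [map_add, LinearMap.add_apply, hx, hy]; abel
  | hpar q b hb =>
    have h := V.commutator ha hb c 1 k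
    rw [finsum_eq_sum_of_support_subset (s := {0, 1})] at h
    · simp only [Finset.sum_pair zero_ne_one, binomC_zero_right, binomC_one_right,
        parSign_zero_left, one_smul] at h
      rw [← sub_eq_iff_eq_add, ← h]
      simp [add_comm]
    · intro j hj
      by_contra hj'
      simp only [Finset.coe_insert, Finset.coe_singleton, Set.mem_insert_iff,
        Set.mem_singleton_iff, not_or] at hj'
      refine hj ?_
      have : binomC 1 j = 0 := by
        have := binomC_natCast 1 j
        rw [Nat.choose_eq_zero_of_lt (by omega)] at this
        simpa using this
      simp [this]

theorem associator {p q : ZMod 2} {a b : W} (ha : a ∈ V.par p) (hb : b ∈ V.par q) (c : W)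
    (n k : ℤ) :
    V.nprod k (V.nprod n a b) c =
    ∑ᶠ j : ℕ, ((-1 : ℂ) ^ j * binomC n j) •
      (V.nprod (n - j) a (V.nprod (k + j) b c) -
        (parSign p q * (-1 : ℂ) ^ n) • V.nprod (n + k - j) b (V.nprod j a c)) := by
  have h := V.borcherds c ha hb 0 n k
  rw [finsum_eq_single _ 0 (fun j hj => by simp [binomC_zero_left hj])] at h
  simpa using h

theorem normal_product_nprod {p q : ZMod 2} {a b : W} (ha : a ∈ V.par p) (hb : b ∈ V.par q)
    (c : W) (k : ℤ) :
    V.nprod k (V.nprod (-1) a b) c =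
    ∑ᶠ j : ℕ, (V.nprod (-1 - j) a (V.nprod (k + j) b c) +
        parSign p q • V.nprod (-1 + k - j) b (V.nprod j a c)) := by
  rw [V.associator ha hb]
  refine finsum_congr fun j => ?_
  rw [binomC_neg_one]
  simp

theorem T_apply (a : W) : V.T a = V.nprod (-2) a V.vac := rfl

theorem T_vac : V.T V.vac = 0 := by simp [T_apply, V.vac_nprod]

/-- In the associator of `a` and the vacuum only the `-1` mode of the vacuum survives. This leaves
the single index `j = -k - 1` of the first sum when `k < 0`, the index `j = k - 1` of the second
when `k > 0`, and nothing when `k = 0`. -/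
theorem nprod_T (a c : W) (k : ℤ) : V.nprod k (V.T a) c = -(k : ℂ) • V.nprod (k - 1) a c := by
  induction a using V.parity_induction with
  | hadd x y hx hy => simp only [map_add, LinearMap.add_apply, hx, hy, smul_add]
  | hpar p a ha =>
    rw [T_apply, V.associator ha V.vac_even]
    simp only [binomC_neg_two, parSign_zero_right, V.vac_nprod]
    obtain rfl | hk | hk : k = 0 ∨ k < 0 ∨ 0 < k := by omega
    · rw [finsum_eq_zero_of_forall_eq_zero]
      · simp
      · intro j
        rw [if_neg (by omega), if_neg (by omega)]
        simp
    · rw [finsum_eq_single _ (-k - 1).toNat]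
      · rw [if_pos (by omega), if_neg (by omega), smul_zero, sub_zero]
        have h1 : (((-k - 1).toNat : ℕ) : ℤ) = -k - 1 := Int.toNat_of_nonneg (by omega)
        have h2 : (((-k - 1).toNat : ℕ) : ℂ) = -(k : ℂ) - 1 := by
          exact_mod_cast congrArg (Int.cast : ℤ → ℂ) h1
        rw [h1, h2, sub_add_cancel, show -2 - (-k - 1) = k - 1 by ring]
      · intro j hj
        rw [if_neg (by omega), if_neg (by omega)]
        simp
    · rw [finsum_eq_single _ (k - 1).toNat]
      · rw [if_neg (by omega), if_pos (by omega), map_zero, zero_sub]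
        have h1 : (((k - 1).toNat : ℕ) : ℤ) = k - 1 := Int.toNat_of_nonneg (by omega)
        have h2 : (((k - 1).toNat : ℕ) : ℂ) = (k : ℂ) - 1 := by
          exact_mod_cast congrArg (Int.cast : ℤ → ℂ) h1
        rw [h1, h2]
        simp
      · intro j hj
        rw [if_neg (by omega), if_neg (by omega)]
        simp

theorem nprod_T_pow (a c : W) (k : ℕ) :
    V.nprod (-1) ((V.T ^ k) a) c = (k.factorial : ℂ) • V.nprod (-1 - k) a c := by
  induction k generalizing a with
  | zero => simp
  | succ k ih =>
    rw [pow_succ, Module.End.mul_apply, ih, nprod_T, smul_smul, Nat.factorial_succ]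
    push_cast
    rw [show (-1 - (k : ℤ) - 1) = -1 - ((k : ℤ) + 1) by ring]
    congr 1
    ring

/-- Associator applied to the vacuum: `a_j 1 = 0` for `j ≥ 0` and `b_{j-2} 1 = 0` for `j ≥ 2`. The
terms `j = 0` and `j = 1` give `a_n (T b)` and `(T a)_n b`. -/
theorem T_nprod (n : ℤ) (a b : W) :
    V.T (V.nprod n a b) = V.nprod n (V.T a) b + V.nprod n a (V.T b) := by
  induction a using V.parity_induction with
  | hadd x y hx hy => simp only [map_add, LinearMap.add_apply, hx, hy]; abel
  | hpar p a ha =>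
    induction b using V.parity_induction with
    | hadd x y hx hy => simp only [map_add, hx, hy]; abel
    | hpar q b hb =>
      rw [T_apply, V.associator ha hb, finsum_eq_sum_of_support_subset (s := {0, 1})]
      · simp [Finset.sum_pair zero_ne_one, V.nprod_vac_of_nonneg, V.nprod_vac, V.nprod_T,
          ← T_apply]
        abel
      · intro j hj
        by_contra hj'
        simp only [Finset.coe_insert, Finset.coe_singleton, Set.mem_insert_iff,
          Set.mem_singleton_iff, not_or] at hj'
        refine hj ?_
        simp [V.nprod_vac_of_nonneg _ (j : ℤ), V.nprod_vac_of_nonneg _ (-2 + j : ℤ) (by omega)]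

/-- This is the commutator of `a_{-1}` and `b_0` on the vacuum, where `b_0 1 = 0` and `a_{-1} 1 =
a`. -/
theorem skew_symmetry {p q : ZMod 2} {a b : W} (ha : a ∈ V.par p) (hb : b ∈ V.par q) :
    V.nprod 0 b a = -(parSign p q • ∑ᶠ j : ℕ, (-1 : ℂ) ^ j •
      V.nprod (-1 - j) (V.nprod j a b) V.vac) := by
  have h := V.commutator ha hb V.vac (-1) 0
  rw [V.nprod_vac, V.nprod_vac_of_nonneg _ 0 le_rfl, map_zero, zero_sub] at h
  have h2 : ∀ j : ℕ, binomC (-1) j = (-1) ^ j := fun j => by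
    have := binomC_neg_one j
    calc binomC (-1) j = (-1 : ℂ) ^ j * ((-1 : ℂ) ^ j * binomC (-1) j) := by
          rw [← mul_assoc, ← mul_pow]; simp
      _ = _ := by rw [this, mul_one]
  simp only [h2, add_zero] at h
  rw [h, smul_neg, smul_smul, parSign_mul_self, one_smul, neg_neg]

end VertexSuperalgebra

end

/-! ### Weight gradings, and replacing one set of strong generators by another. -/

noncomputable section

namespace VertexSuperalgebra

variable {W : Type*} [AddCommGroup W] [Module ℂ W] (V : VertexSuperalgebra W)

/-- A grading of a vertex algebra by conformal weights in `½ ℤ_{≥ 0}`, with one-dimensional (or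
zero) weight-zero space; `G n` is the space of vectors of weight `n / 2`. -/
structure IsWeightGrading (G : ℤ → Submodule ℂ W) : Prop where
  indep : iSupIndep G
  iSup_eq_top : ⨆ n, G n = ⊤
  eq_bot_of_neg : ∀ n < 0, G n = ⊥
  zero_le : G 0 ≤ Submodule.span ℂ {V.vac}
  vac_mem : V.vac ∈ G 0
  nprod_mem : ∀ (k m n : ℤ) (a b : W), a ∈ G m → b ∈ G n → V.nprod k a b ∈ G (m + n - 2 * k - 2)

/-- Right-nested normally ordered monomials in derivatives of homogeneous elements of `A`, with
their parity and weight. -/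
inductive GradedMonomial (G : ℤ → Submodule ℂ W) (A : Set W) : ZMod 2 → ℤ → W → Prop
  | vac : GradedMonomial G A 0 0 V.vac
  | cons {p q : ZMod 2} {m n : ℤ} {x w : W} (k : ℕ) : x ∈ A → x ∈ V.par p → x ∈ G m →
      GradedMonomial G A q n w → GradedMonomial G A (p + q) (m + 2 * k + n) (V.nprod (-1 - k) x w)

/-- The span of the graded monomials of weight `n / 2`. -/
def monomialSpan (G : ℤ → Submodule ℂ W) (A : Set W) (n : ℤ) : Submodule ℂ W :=
  Submodule.span ℂ {w | ∃ p, V.GradedMonomial G A p n w}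

/-- Each element of `A` is homogeneous with respect to the weight, and its even and odd components
belong to `A`. -/
def IsHomogeneousSet (G : ℤ → Submodule ℂ W) (A : Set W) : Prop :=
  ∀ x ∈ A, ∃ m, ∃ y ∈ A, ∃ z ∈ A, y ∈ V.par 0 ∧ z ∈ V.par 1 ∧ y ∈ G m ∧ z ∈ G m ∧ x = y + z

variable {V} {G : ℤ → Submodule ℂ W} {A : Set W}

theorem IsWeightGrading.eq_or_eq_zero (hG : V.IsWeightGrading G) {m n : ℤ} {x : W}
    (hm : x ∈ G m) (hn : x ∈ G n) : m = n ∨ x = 0 := by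
  by_contra! h
  exact h.2 (Submodule.disjoint_def.1 (hG.indep.pairwiseDisjoint h.1) x hm hn)

theorem GradedMonomial.mem_par {p : ZMod 2} {n : ℤ} {w : W} (h : V.GradedMonomial G A p n w) :
    w ∈ V.par p := by
  induction h with
  | vac => exact V.vac_even
  | cons k _ hp _ _ ih => exact V.nprod_mem _ hp ih

theorem GradedMonomial.mem_weight (hG : V.IsWeightGrading G) {p : ZMod 2} {n : ℤ} {w : W}
    (h : V.GradedMonomial G A p n w) : w ∈ G n := by
  induction h with
  | vac => exact hG.vac_mem
  | @cons p q m n x w k _ _ hm _ ih =>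
    have := hG.nprod_mem (-1 - k) m n x w hm ih
    rwa [show m + n - 2 * (-1 - k) - 2 = m + 2 * k + n by ring] at this

theorem monomialSpan_le (hG : V.IsWeightGrading G) (n : ℤ) : V.monomialSpan G A n ≤ G n :=
  Submodule.span_le.2 fun _ ⟨_, h⟩ => h.mem_weight hG

theorem vac_mem_monomialSpan : V.vac ∈ V.monomialSpan G A 0 :=
  Submodule.subset_span ⟨_, .vac⟩

theorem nprod_mem_monomialSpan {p : ZMod 2} {m n : ℤ} {x w : W} (k : ℕ) (hA : x ∈ A)
    (hp : x ∈ V.par p) (hm : x ∈ G m) (hw : w ∈ V.monomialSpan G A n) :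
    V.nprod (-1 - k) x w ∈ V.monomialSpan G A (m + 2 * k + n) := by
  induction hw using Submodule.span_induction with
  | mem w h => exact Submodule.subset_span ⟨_, .cons k hA hp hm h.choose_spec⟩
  | zero => simp
  | add x y _ _ hx hy => simpa using add_mem hx hy
  | smul c x _ hx => simpa using Submodule.smul_mem _ c hx

theorem T_nprod_neg (k : ℕ) (x w : W) :
    V.T (V.nprod (-1 - k) x w) =
      ((k : ℂ) + 1) • V.nprod (-1 - (k + 1 : ℕ)) x w + V.nprod (-1 - k) x (V.T w) := by
  rw [V.T_nprod, V.nprod_T]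
  congr 1
  push_cast
  rw [show -1 - (k : ℤ) - 1 = -1 - (k + 1) by ring]
  congr 1
  ring

theorem T_mem_monomialSpan {n : ℤ} {w : W} (hw : w ∈ V.monomialSpan G A n) :
    V.T w ∈ V.monomialSpan G A (n + 2) := by
  induction hw using Submodule.span_induction with
  | mem w h =>
    obtain ⟨p, h⟩ := h
    induction h with
    | vac => simp [T_vac]
    | @cons p q m n x w k hA hp hm h ih =>
      rw [T_nprod_neg]
      refine add_mem (Submodule.smul_mem _ _ ?_) ?_
      · have := nprod_mem_monomialSpan (k + 1) hA hp hm
          (Submodule.subset_span ⟨q, h⟩ : w ∈ V.monomialSpan G A n)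
        rwa [show m + 2 * ((k + 1 : ℕ) : ℤ) + n = m + 2 * k + n + 2 by push_cast; ring] at this
      · have := nprod_mem_monomialSpan k hA hp hm ih
        rwa [← add_assoc] at this
  | zero => simp
  | add x y _ _ hx hy => simpa using add_mem hx hy
  | smul c x _ hx => simpa using Submodule.smul_mem _ c hx

theorem T_pow_mem_monomialSpan {n : ℤ} {w : W} (hw : w ∈ V.monomialSpan G A n) (k : ℕ) :
    (V.T ^ k) w ∈ V.monomialSpan G A (n + 2 * k) := by
  induction k with
  | zero => simpa using hw
  | succ k ih =>
    rw [pow_succ', Module.End.mul_apply]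
    have := T_mem_monomialSpan ih
    rwa [show n + 2 * (k : ℤ) + 2 = n + 2 * ((k + 1 : ℕ) : ℤ) by push_cast; ring] at this

theorem nprod_neg_eq (k : ℕ) (x w : W) :
    V.nprod (-1 - k) x w = (k.factorial : ℂ)⁻¹ • V.nprod (-1) ((V.T ^ k) x) w := by
  rw [V.nprod_T_pow, smul_smul, inv_mul_cancel₀ (by exact_mod_cast k.factorial_ne_zero), one_smul]

theorem monomialSpan_le_span_monomial (n : ℤ) : V.monomialSpan G A n ≤
    Submodule.span ℂ {w : W | ∃ l : List (ℕ × W), (∀ x ∈ l, x.2 ∈ A) ∧ V.monomial l = w} := by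
  refine Submodule.span_le.2 ?_
  rintro w ⟨p, h⟩
  induction h with
  | vac => exact Submodule.subset_span ⟨[], by simp, rfl⟩
  | @cons p q m n x w k hA hp hm h ih =>
    rw [SetLike.mem_coe] at ih ⊢
    clear h
    induction ih using Submodule.span_induction with
    | mem w h =>
      obtain ⟨l, hl, rfl⟩ := h
      rw [nprod_neg_eq]
      refine Submodule.smul_mem _ _ (Submodule.subset_span ⟨(k, x) :: l, ?_, rfl⟩)
      simpa using ⟨hA, fun a b h => hl (a, b) h⟩
    | zero => simp
    | add x y _ _ hx hy => simpa using add_mem hx hy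
    | smul c x _ hx => simpa using Submodule.smul_mem _ c hx

theorem span_monomial_le_iSup (hA : V.IsHomogeneousSet G A) :
    Submodule.span ℂ {w : W | ∃ l : List (ℕ × W), (∀ x ∈ l, x.2 ∈ A) ∧ V.monomial l = w} ≤
      ⨆ n, V.monomialSpan G A n := by
  refine Submodule.span_le.2 ?_
  rintro _ ⟨l, hl, rfl⟩
  induction l with
  | nil => exact Submodule.mem_iSup_of_mem 0 vac_mem_monomialSpan
  | cons x l ih =>
    have ih := ih fun x hx => hl x (List.mem_cons_of_mem _ hx)
    obtain ⟨k, x⟩ := x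
    change V.nprod (-1) ((V.T ^ k) x) (V.monomial l) ∈ _
    rw [V.nprod_T_pow]
    refine Submodule.smul_mem _ _ ?_
    rw [SetLike.mem_coe] at ih
    generalize V.monomial l = w at ih ⊢
    obtain ⟨m, y, hyA, z, hzA, hy, hz, hym, hzm, rfl⟩ := hA x (hl _ List.mem_cons_self)
    induction ih using Submodule.iSup_induction' with
    | mem n w hw =>
      rw [map_add, LinearMap.add_apply]
      exact add_mem (Submodule.mem_iSup_of_mem _ (nprod_mem_monomialSpan k hyA hy hym hw))
        (Submodule.mem_iSup_of_mem _ (nprod_mem_monomialSpan k hzA hz hzm hw))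
    | zero => simp
    | add x y _ _ hx hy => simpa only [map_add] using add_mem hx hy

/-- Splitting each generator into its even and odd parts turns arbitrary monomials into graded ones,
so that strong generation can be tested weight by weight. -/
theorem stronglyGenerates_iff (hA : V.IsHomogeneousSet G A) :
    V.StronglyGenerates A ↔ ⨆ n, V.monomialSpan G A n = ⊤ := by
  constructor
  · intro h
    exact top_le_iff.1 (h.symm.le.trans (span_monomial_le_iSup hA))
  · intro h
    exact top_le_iff.1 (h.symm.le.trans (iSup_le monomialSpan_le_span_monomial))

/-- The modular law: the other `N j` together meet `G i` trivially, so they cannot contribute to it.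
-/
theorem eq_of_le_of_iSup_eq_top {R M ι : Type*} [Ring R] [AddCommGroup M] [Module R M]
    {G N : ι → Submodule R M} (hG : iSupIndep G) (hle : ∀ i, N i ≤ G i) (hN : ⨆ i, N i = ⊤)
    (i : ι) : N i = G i := by
  refine le_antisymm (hle i) ?_
  have h1 : N i ⊔ ⨆ (j) (_ : j ≠ i), N j = ⊤ := by
    rw [← hN]; exact (iSup_split_single N i).symm
  have h2 : (⨆ (j) (_ : j ≠ i), N j) ⊓ G i = ⊥ := by
    refine disjoint_iff.1 ((hG i).symm.mono_left ?_)
    exact iSup₂_mono fun j _ => hle j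
  calc G i = (N i ⊔ ⨆ (j) (_ : j ≠ i), N j) ⊓ G i := by rw [h1, top_inf_eq]
    _ = N i ⊔ (⨆ (j) (_ : j ≠ i), N j) ⊓ G i := sup_inf_assoc_of_le _ (hle i)
    _ ≤ N i := by rw [h2, sup_bot_eq]

theorem finsum_mem_submodule {R M : Type*} [Ring R] [AddCommGroup M] [Module R M] {ι : Type*}
    (N : Submodule R M) {f : ι → M} (h : ∀ i, f i ∈ N) : ∑ᶠ i, f i ∈ N :=
  finsum_induction (· ∈ N) N.zero_mem (fun _ _ => N.add_mem) h

/-- Renesting to the right, by induction on the monomial `u`. The associator turns `(x_{-1-k}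
b)_{-1-n} v` into terms `x_{-1-k-j} (b_i v)`, whose outer factor is a generator, and terms `b_{-1-l}
(x_j v)`, where the shorter monomial `b` acts on another vector of weight below `d`. The latter is
why `n`, `f` and `v` vary in the induction. -/
theorem GradedMonomial.nprod_mem_monomialSpan (hG : V.IsWeightGrading G) {d : ℤ}
    (hd : ∀ e < d, G e ≤ V.monomialSpan G A e) {q : ZMod 2} {e : ℤ} {u : W}
    (hu : V.GradedMonomial G A q e u) {f : ℤ} {v : W} (n : ℕ) (he : e < d) (hf : f < d)
    (hv : v ∈ G f) (h : e + f + 2 * n = d) :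
    V.nprod (-1 - n) u v ∈ V.monomialSpan G A d := by
  induction hu generalizing n f v with
  | vac =>
    rw [V.vac_nprod, if_neg (by omega)]
    exact zero_mem _
  | @cons p q m e x b k hA hp hm hb ih =>
    obtain hm0 | hm0 := lt_or_ge m 0
    · rw [hG.eq_bot_of_neg m hm0, Submodule.mem_bot] at hm
      simp [hm]
    have hbG := hb.mem_weight hG
    rw [V.associator hp hb.mem_par]
    refine finsum_mem_submodule _ fun j => Submodule.smul_mem _ _ (sub_mem ?_
      (Submodule.smul_mem _ _ ?_))
    · rw [show (-1 - (k : ℤ) - j) = -1 - (k + j : ℕ) by push_cast; ring]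
      have hin : V.nprod (-1 - n + j) b v ∈ V.monomialSpan G A (d - m - 2 * k - 2 * j) := by
        have := hG.nprod_mem (-1 - n + j) e f b v hbG hv
        rw [show e + f - 2 * (-1 - (n : ℤ) + j) - 2 = d - m - 2 * k - 2 * j by
          rw [← h]; ring] at this
        obtain hlt | hge := lt_or_ge (d - m - 2 * k - 2 * j) d
        · exact hd _ hlt this
        -- The weight of the inner vector fails to drop below `d` only if `m = k = j = 0`. Then `b`
        -- has the weight of the whole monomial, and the induction hypothesis covers `b_{-1-n} v`.
        · obtain rfl : j = 0 := by omega
          obtain rfl : k = 0 := by omega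
          obtain rfl : m = 0 := by omega
          simpa using ih n (by simpa using he) hf hv (by simpa using h)
      have := VertexSuperalgebra.nprod_mem_monomialSpan (k + j) hA hp hm hin
      rwa [show m + 2 * ((k + j : ℕ) : ℤ) + (d - m - 2 * k - 2 * j) = d by push_cast; ring] at this
    · rw [show -1 - (k : ℤ) + (-1 - n) - j = -1 - (k + n + j + 1 : ℕ) by push_cast; ring]
      obtain he0 | he0 := lt_or_ge e 0
      · rw [hG.eq_bot_of_neg e he0, Submodule.mem_bot] at hbG
        simp [hbG]
      refine ih (f := m + f - 2 * j - 2) _ (by omega) (by omega) (hG.nprod_mem _ _ _ _ _ hm hv) ?_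
      push_cast
      linarith

theorem nprod_mem_monomialSpan_of_weight_lt (hG : V.IsWeightGrading G) {d : ℤ}
    (hd : ∀ e < d, G e ≤ V.monomialSpan G A e) {e f : ℤ} {u v : W} (n : ℕ) (he : e < d)
    (hf : f < d) (hu : u ∈ G e) (hv : v ∈ G f) (h : e + f + 2 * n = d) :
    V.nprod (-1 - n) u v ∈ V.monomialSpan G A d := by
  replace hu := hd e he hu
  induction hu using Submodule.span_induction with
  | mem u hu => exact hu.choose_spec.nprod_mem_monomialSpan hG hd n he hf hv h
  | zero => simp
  | add x y _ _ ihx ihy =>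
    simpa using add_mem ihx ihy
  | smul c x _ ihx => simpa using Submodule.smul_mem _ c ihx

theorem nprod_smul_vac_mem_monomialSpan {m : ℤ} {x w : W} (hw : w ∈ Submodule.span ℂ {V.vac})
    (hx : x ∈ V.monomialSpan G A m) (k : ℕ) :
    V.nprod (-1 - k) x w ∈ V.monomialSpan G A (m + 2 * k) := by
  obtain ⟨c, rfl⟩ := Submodule.mem_span_singleton.1 hw
  rw [map_smul, nprod_neg_eq, V.nprod_vac]
  exact Submodule.smul_mem _ _ (Submodule.smul_mem _ _ (T_pow_mem_monomialSpan hx k))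

/-- If each element of a strongly generating set `X` is, modulo elements of smaller weight, a
combination of monomials in `A`, then `A` strongly generates. -/
theorem StronglyGenerates.of_forall_mem_monomialSpan (hG : V.IsWeightGrading G) {X : Set W}
    (hX : V.StronglyGenerates X) (hXh : V.IsHomogeneousSet G X) (hAh : V.IsHomogeneousSet G A)
    (h : ∀ x ∈ X, ∀ p, x ∈ V.par p → ∀ m, x ∈ G m → (∀ e < m, G e ≤ V.monomialSpan G A e) →
      x ∈ V.monomialSpan G A m) : V.StronglyGenerates A := by
  -- Strong generation by `X` gives each weight space separately, so only graded monomials in `X`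
  -- need be rewritten.
  have hGX : ∀ d, V.monomialSpan G X d = G d :=
    eq_of_le_of_iSup_eq_top hG.indep (monomialSpan_le hG) ((stronglyGenerates_iff hXh).1 hX)
  have hstep : ∀ d, (∀ e < d, G e ≤ V.monomialSpan G A e) → G d ≤ V.monomialSpan G A d := by
    intro d hd
    rw [← hGX]
    refine Submodule.span_le.2 ?_
    rintro w ⟨p, hw⟩
    rw [SetLike.mem_coe]
    suffices ∀ n p, V.GradedMonomial G X p n w → n = d → w ∈ V.monomialSpan G A d from
      this d p hw rfl
    clear hw
    intro n p hw
    induction hw with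
    | vac => rintro rfl; exact vac_mem_monomialSpan
    | @cons p q m n x w k hx hp hm hw ih =>
      intro hdeg
      obtain hm0 | hm0 := lt_or_ge m 0
      · rw [hG.eq_bot_of_neg m hm0, Submodule.mem_bot] at hm
        simp [hm]
      have hwG := hw.mem_weight hG
      -- If the tail `w` has weight zero it is a multiple of the vacuum, and `x_{-1-k} 1` is a
      -- multiple of `T^k x`, to which `h` applies. If it has positive weight, then `x` has weight
      -- below `d`. Both factors are then of smaller weight unless `m = k = 0`, in which case `x` is
      -- itself a multiple of the vacuum.
      obtain hn0 | hn0 | hn0 := lt_trichotomy n 0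
      · rw [hG.eq_bot_of_neg n hn0, Submodule.mem_bot] at hwG
        simp [hwG]
      · subst hn0
        rw [← hdeg, add_zero]
        refine nprod_smul_vac_mem_monomialSpan (hG.zero_le hwG) ?_ k
        exact h x hx p hp m hm fun e he => hd e (by omega)
      · obtain hlt | hge := lt_or_ge n d
        · exact nprod_mem_monomialSpan_of_weight_lt hG hd k (by omega) hlt hm hwG (by omega)
        · obtain rfl : m = 0 := by omega
          obtain rfl : k = 0 := by omega
          obtain ⟨c, rfl⟩ := Submodule.mem_span_singleton.1 (hG.zero_le hm)
          simpa [V.vac_nprod] using Submodule.smul_mem _ c (ih (by simpa using hdeg))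
  have hall : ∀ (N : ℕ) (d : ℤ), d < N → G d ≤ V.monomialSpan G A d := by
    intro N
    induction N with
    | zero =>
      intro d hd
      rw [hG.eq_bot_of_neg d (by simpa using hd)]
      exact bot_le
    | succ N ih =>
      intro d hd
      exact hstep d fun e he => ih e (by push_cast at hd; omega)
  rw [stronglyGenerates_iff hAh, eq_top_iff, ← hG.iSup_eq_top]
  exact iSup_mono fun d => hall (d.toNat + 1) d (by push_cast; omega)

/-- Independence of the images is an assumption because an arbitrary ideal is not presumed to be
compatible with `G`. -/
theorem IsWeightGrading.quotient (hG : V.IsWeightGrading G) {I : Submodule ℂ W} (hI : V.IsIdeal I)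
    (hindep : iSupIndep fun n => (G n).map I.mkQ) :
    (V.quotient hI).IsWeightGrading fun n => (G n).map I.mkQ where
  indep := hindep
  iSup_eq_top := by
    rw [← Submodule.map_iSup, hG.iSup_eq_top, Submodule.map_top, Submodule.range_mkQ]
  eq_bot_of_neg n hn := by rw [hG.eq_bot_of_neg n hn, Submodule.map_bot]
  zero_le := by
    refine (Submodule.map_mono hG.zero_le).trans ?_
    rw [Submodule.map_span, Set.image_singleton]
    exact le_rfl
  vac_mem := ⟨_, hG.vac_mem, rfl⟩
  nprod_mem := by
    rintro k m n _ _ ⟨a, ha, rfl⟩ ⟨b, hb, rfl⟩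
    exact ⟨_, hG.nprod_mem k m n a b ha hb, rfl⟩

theorem isHomogeneousSet_image_mkQ {I : Submodule ℂ W} (hI : V.IsIdeal I) {A : Set W}
    (hA : ∀ x ∈ A, ∃ N : Submodule ℂ W, x ∈ N ∧ (N : Set W) ⊆ A ∧ V.IsGraded N ∧ ∃ m, N ≤ G m) :
    (V.quotient hI).IsHomogeneousSet (fun n => (G n).map I.mkQ) (I.mkQ '' A) := by
  rintro _ ⟨x, hx, rfl⟩
  obtain ⟨N, hxN, hNA, hN, m, hm⟩ := hA x hx
  obtain ⟨y, hy, z, hz, rfl⟩ := V.exists_parity x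
  obtain ⟨hyN, hzN⟩ := hN y hy z hz hxN
  exact ⟨m, _, ⟨y, hNA hyN, rfl⟩, _, ⟨z, hNA hzN, rfl⟩, ⟨y, hy, rfl⟩, ⟨z, hz, rfl⟩,
    ⟨y, hm hyN, rfl⟩, ⟨z, hm hzN, rfl⟩, map_add _ _ _⟩

end VertexSuperalgebra

end

/-! ### Zero modes of normally ordered products of currents, and Casimir elements. -/

noncomputable section

namespace VertexSuperalgebra

variable {W : Type*} [AddCommGroup W] [Module ℂ W] {V : VertexSuperalgebra W}
  {G : ℤ → Submodule ℂ W}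

/-- The corrections to antisymmetry vanish: `a_1 b` is a multiple of the vacuum, which `T` kills,
and the higher products have negative weight. -/
theorem IsWeightGrading.skew_symmetry (hG : V.IsWeightGrading G) {p q : ZMod 2} {a b : W}
    (ha : a ∈ V.par p) (hb : b ∈ V.par q) (ha2 : a ∈ G 2) (hb2 : b ∈ G 2) :
    V.nprod 0 b a = -(parSign p q • V.nprod 0 a b) := by
  rw [V.skew_symmetry ha hb, finsum_eq_single _ 0]
  · simp [V.nprod_vac]
  · intro j hj
    have h := hG.nprod_mem j 2 2 a b ha2 hb2
    obtain rfl | hj1 : j = 1 ∨ 1 < j := by omega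
    · obtain ⟨c, hc⟩ := Submodule.mem_span_singleton.1 (hG.zero_le (by simpa using h))
      have hc : V.nprod ((1 : ℕ) : ℤ) a b = c • V.vac := hc.symm
      rw [hc]
      simp [V.vac_nprod]
    · rw [hG.eq_bot_of_neg _ (by omega), Submodule.mem_bot] at h
      simp [h]

/-- The span of the vectors `a_{-1-n} v` of weight `d / 2`, with `n ≥ 0` and `a` a homogeneous
vector of weight one. -/
def currentDescendants (V : VertexSuperalgebra W) (G : ℤ → Submodule ℂ W) (d : ℤ) :
    Submodule ℂ W :=
  Submodule.span ℂ {w | ∃ n : ℕ, ∃ p, ∃ a ∈ G 2, a ∈ V.par p ∧ ∃ v ∈ G (d - 2 * n - 2),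
    V.nprod (-1 - n) a v = w}

/-- In the expansion of `(a_{-1} b)_1 w` every term has an outer mode of negative index, except the
one containing `b_0 a_0 w`, which occurs at `j = 0`. -/
theorem IsWeightGrading.normal_product_zero_mode_mem (hG : V.IsWeightGrading G) {p q : ZMod 2}
    {a b w : W} {d : ℤ} (ha : a ∈ V.par p) (hb : b ∈ V.par q) (ha2 : a ∈ G 2) (hb2 : b ∈ G 2)
    (hw : w ∈ G d) :
    V.nprod 1 (V.nprod (-1) a b) w - parSign p q • V.nprod 0 b (V.nprod 0 a w) ∈
      V.currentDescendants G d := by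
  have hterm : ∀ j : ℕ, V.nprod (-1 - j) a (V.nprod (1 + j) b w) ∈ V.currentDescendants G d :=
    fun j => Submodule.subset_span ⟨j, p, a, ha2, ha, _, by
      have := hG.nprod_mem (1 + j) 2 d b w hb2 hw
      rwa [show 2 + d - 2 * (1 + (j : ℤ)) - 2 = d - 2 * j - 2 by ring] at this, rfl⟩
  have hterm' : ∀ j : ℕ, V.nprod (-(j + 1 : ℕ)) b (V.nprod (j + 1 : ℕ) a w) ∈
      V.currentDescendants G d := fun j => Submodule.subset_span ⟨j, q, b, hb2, hb, _, by
      have := hG.nprod_mem (j + 1 : ℕ) 2 d a w ha2 hw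
      rwa [show 2 + d - 2 * ((j + 1 : ℕ) : ℤ) - 2 = d - 2 * j - 2 by push_cast; ring] at this,
      by rw [show -((j + 1 : ℕ) : ℤ) = -1 - j by push_cast; ring]⟩
  rw [V.normal_product_nprod ha hb]
  set f : ℕ → W := fun j => V.nprod (-1 - j) a (V.nprod (1 + j) b w) +
        parSign p q • V.nprod (-1 + 1 - j) b (V.nprod j a w) with hf
  have hfin : f.support.Finite := by
    have := V.finite_right a b w 0 (-1) 1 (parSign p q * (-1) ^ (-1 : ℤ))
    refine this.subset fun j hj => ?_
    simpa [hf, binomC_neg_one] using hj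
  have hsplit : ∑ᶠ j, f j = parSign p q • V.nprod 0 b (V.nprod 0 a w) +
      ∑ᶠ j, (f j - if j = 0 then parSign p q • V.nprod 0 b (V.nprod 0 a w) else 0) := by
    have hfin' : (Function.support fun j : ℕ => if j = 0 then
        parSign p q • V.nprod 0 b (V.nprod 0 a w) else 0).Finite :=
      (Set.finite_singleton 0).subset fun j hj => by
        by_contra h
        exact hj (if_neg h)
    rw [finsum_sub_distrib hfin hfin', finsum_eq_single (fun j : ℕ => if j = 0 then _ else _) 0
      fun j hj => if_neg hj]
    simp
  rw [hsplit, add_sub_cancel_left]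
  refine finsum_mem_submodule _ fun j => ?_
  cases j with
  | zero => simpa [hf] using hterm 0
  | succ j =>
    rw [if_neg (by omega), sub_zero, hf]
    refine add_mem (hterm _) (Submodule.smul_mem _ _ ?_)
    simpa using hterm' j

section Casimir

variable {g : Submodule ℂ W} {β : LinearMap.BilinForm ℂ g} {ι : Type*} [Fintype ι]
  [DecidableEq ι]

theorem IsInvariantForm.eq_zero_of_ne (hβ : V.IsInvariantForm g β) {p q : ZMod 2} (hpq : p ≠ q)
    {x y : g} (hx : (x : W) ∈ V.par p) (hy : (y : W) ∈ V.par q) : β x y = 0 := by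
  obtain ⟨rfl, rfl⟩ | ⟨rfl, rfl⟩ : p = 0 ∧ q = 1 ∨ p = 1 ∧ q = 0 := by
    clear hx hy; revert p q; decide
  · exact hβ.even x y hx hy
  · rw [hβ.supersymm _ _ y x hy hx, hβ.even y x hy hx, mul_zero]

/-- The form is only supersymmetric, so the order of its arguments matters: expansion in the dual
basis pairs with `b` on the right, expansion in `b` pairs with the dual basis on the left. -/
theorem sum_apply_dualBasis_smul (hnd : β.Nondegenerate) (b : Module.Basis ι ℂ g) (x : g) :
    ∑ n, β x (b n) • β.dualBasis hnd b n = x := by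
  conv_rhs => rw [← (β.dualBasis hnd b).sum_repr x]
  simp only [LinearMap.BilinForm.dualBasis_repr_apply]

theorem sum_dualBasis_apply_smul (hnd : β.Nondegenerate) (b : Module.Basis ι ℂ g) (x : g) :
    ∑ n, β (β.dualBasis hnd b n) x • b n = x := by
  conv_rhs => rw [← b.sum_repr x]
  refine Finset.sum_congr rfl fun n _ => ?_
  have h := congrArg (β (β.dualBasis hnd b n)) (b.sum_repr x)
  simp only [map_sum, map_smul, LinearMap.BilinForm.apply_dualBasis_left, smul_eq_mul, mul_ite,
    mul_one, mul_zero, Finset.sum_ite_eq', Finset.mem_univ, if_true] at h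
  rw [h]

theorem IsInvariantForm.dualBasis_mem_par (hβ : V.IsInvariantForm g β) (hg : V.IsGraded g)
    (hnd : β.Nondegenerate) (b : Module.Basis ι ℂ g) {π : ι → ZMod 2}
    (hb : ∀ m, (b m : W) ∈ V.par (π m)) (m : ι) :
    (β.dualBasis hnd b m : W) ∈ V.par (π m) := by
  have key : ∀ x y : g, ∀ p q : ZMod 2, (x : W) ∈ V.par p → (y : W) ∈ V.par q → p ≠ q →
      x + y = β.dualBasis hnd b m → π m = p → (β.dualBasis hnd b m : W) ∈ V.par (π m) := by
    intro x y p q hx hy hpq hxy hp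
    suffices y = 0 by rw [← hxy, this, add_zero, hp]; exact hx
    rw [← sum_apply_dualBasis_smul hnd b y]
    refine Finset.sum_eq_zero fun n _ => ?_
    suffices β y (b n) = 0 by rw [this, zero_smul]
    -- `y` is the component of the wrong parity. It pairs to zero with basis vectors of the other
    -- parity by evenness. With those of its own parity it pairs as the whole dual vector does,
    -- hence to zero, since such an `n` differs from `m`.
    by_cases hn : q = π n
    · have h1 : β (x + y) (b n) = 0 := by
        rw [hxy, LinearMap.BilinForm.apply_dualBasis_left, if_neg]
        rintro rfl
        exact hpq (hp.symm.trans hn.symm)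
      rw [map_add, LinearMap.add_apply,
        hβ.eq_zero_of_ne (fun h => hpq (h.trans hn.symm)) hx (hb n), zero_add] at h1
      exact h1
    · exact hβ.eq_zero_of_ne hn hy (hb n)
  obtain ⟨x, hx, y, hy, hxy⟩ := V.exists_parity (β.dualBasis hnd b m : W)
  obtain ⟨hxg, hyg⟩ := hg x hx y hy (hxy ▸ (β.dualBasis hnd b m).2)
  have h01 : π m = 0 ∨ π m = 1 := by generalize π m = p; revert p; decide
  obtain h | h := h01
  · exact key ⟨x, hxg⟩ ⟨y, hyg⟩ 0 1 hx hy (by decide) (Subtype.ext hxy) h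
  · exact key ⟨y, hyg⟩ ⟨x, hxg⟩ 1 0 hy hx (by decide) (Subtype.ext ((add_comm y x).trans hxy)) h

/-- The two orderings of the canonical element of a supersymmetric form. -/
theorem IsInvariantForm.sum_basis_dualBasis (hβ : V.IsInvariantForm g β)
    (hnd : β.Nondegenerate) (b : Module.Basis ι ℂ g) {π : ι → ZMod 2}
    (hb : ∀ m, (b m : W) ∈ V.par (π m)) (f : g →ₗ[ℂ] g →ₗ[ℂ] W) :
    ∑ m, parSign (π m) (π m) • f (β.dualBasis hnd b m) (b m) =
      ∑ m, f (b m) (β.dualBasis hnd b m) := by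
  set x := β.dualBasis hnd b
  have h1 : ∀ m, f (x m) (b m) = ∑ n, β (b m) (b n) • f (x m) (x n) := fun m => by
    conv_lhs => rw [← sum_apply_dualBasis_smul hnd b (b m)]
    simp [x]
  have h2 : ∀ m, f (b m) (x m) = ∑ n, β (b m) (b n) • f (x n) (x m) := fun m => by
    conv_lhs => rw [← sum_apply_dualBasis_smul hnd b (b m)]
    simp [x]
  simp only [h1, h2, Finset.smul_sum, smul_smul]
  rw [Finset.sum_comm]
  refine Finset.sum_congr rfl fun m _ => Finset.sum_congr rfl fun n _ => ?_
  congr 1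
  by_cases h : π m = π n
  · rw [hβ.supersymm _ _ (b m) (b n) (hb m) (hb n), h, ← mul_assoc, parSign_mul_self, one_mul]
  · rw [hβ.eq_zero_of_ne h (hb m) (hb n), hβ.eq_zero_of_ne (Ne.symm h) (hb n) (hb m), mul_zero]

/-- The matrices of `ad a` in the two dual bases are negative transposes of each other up to sign
(`hcoef`, from invariance and skew-symmetry), so the two commutator sums cancel. -/
theorem IsInvariantForm.casimir_comm (hβ : V.IsInvariantForm g β) (hg : V.IsGraded g)
    (hbr : ∀ x ∈ g, ∀ y ∈ g, V.nprod 0 x y ∈ g) (hG : V.IsWeightGrading G) (hg2 : g ≤ G 2)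
    (hnd : β.Nondegenerate) (b : Module.Basis ι ℂ g) {π : ι → ZMod 2}
    (hb : ∀ m, (b m : W) ∈ V.par (π m)) {p : ZMod 2} {a : W} (hap : a ∈ V.par p) (ha : a ∈ g)
    (w : W) :
    V.nprod 0 a (∑ m, V.nprod 0 (b m : W) (V.nprod 0 (β.dualBasis hnd b m : W) w)) =
      ∑ m, V.nprod 0 (b m : W) (V.nprod 0 (β.dualBasis hnd b m : W) (V.nprod 0 a w)) := by
  have hx := hβ.dualBasis_mem_par hg hnd b hb
  set x := β.dualBasis hnd b with hxdef
  let u : ι → g := fun m => ⟨V.nprod 0 a (b m), hbr _ ha _ (b m).2⟩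
  let v : ι → g := fun m => ⟨V.nprod 0 a (x m), hbr _ ha _ (x m).2⟩
  have hu : ∀ m, V.nprod 0 a (b m) = ∑ n, β (x n) (u m) • (b n : W) := fun m => by
    have := congrArg g.subtype (sum_dualBasis_apply_smul hnd b (u m))
    simpa using this.symm
  have hv : ∀ m, V.nprod 0 a (x m) = ∑ n, β (v m) (b n) • (x n : W) := fun m => by
    have := congrArg g.subtype (sum_apply_dualBasis_smul hnd b (v m))
    simpa using this.symm
  have hcoef : ∀ m n, β (x n) (u m) + parSign p (π n) * β (v n) (b m) = 0 := fun m n => by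
    have h1 := hβ.invariant (x n) ⟨a, ha⟩ (b m) ⟨V.nprod 0 (x n : W) a, hbr _ (x n).2 _ ha⟩ (u m)
      rfl rfl
    have h2 : (⟨V.nprod 0 (x n : W) a, hbr _ (x n).2 _ ha⟩ : g) = -(parSign p (π n) • v n) :=
      Subtype.ext (hG.skew_symmetry hap (hx n) (hg2 ha) (hg2 (x n).2))
    rw [← h1, h2]
    simp
  have hterm : ∀ m, V.nprod 0 a (V.nprod 0 (b m : W) (V.nprod 0 (x m : W) w)) =
      ∑ n, β (x n) (u m) • V.nprod 0 (b n : W) (V.nprod 0 (x m : W) w) +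
      ∑ n, (parSign p (π m) * β (v m) (b n)) • V.nprod 0 (b m : W) (V.nprod 0 (x n : W) w) +
      V.nprod 0 (b m : W) (V.nprod 0 (x m : W) (V.nprod 0 a w)) := fun m => by
    rw [V.zero_mode_commutator hap (hb m), V.zero_mode_commutator hap (hx m), hu, hv]
    simp only [map_add, map_sum, map_smul, LinearMap.sum_apply, LinearMap.smul_apply, smul_add,
      Finset.smul_sum, smul_smul, parSign_mul_self, one_smul]
    abel
  rw [map_sum, Finset.sum_congr rfl fun m _ => hterm m, Finset.sum_add_distrib,
    Finset.sum_add_distrib, add_eq_right]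
  conv_lhs => enter [2]; rw [Finset.sum_comm]
  rw [← Finset.sum_add_distrib]
  refine Finset.sum_eq_zero fun m _ => ?_
  rw [← Finset.sum_add_distrib]
  refine Finset.sum_eq_zero fun n _ => ?_
  rw [← add_smul, hcoef, zero_smul]

end Casimir

end VertexSuperalgebra
end

/-! ### The conformal grading, Schur's lemma, and the action of the Sugawara vector. -/

noncomputable section

theorem apply_eq_scalarOn_smul {W : Type*} [AddCommGroup W] [Module ℂ W] {f : Module.End ℂ W}
    {S : Submodule ℂ W} (h : ∃ c : ℂ, ∀ v ∈ S, f v = c • v) {v : W} (hv : v ∈ S) :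
    f v = scalarOn f S • v :=
  Classical.epsilon_spec h v hv

/-- Strong generators of `W` which vanish in a quotient may be omitted there. -/
theorem VertexSuperalgebra.StronglyGenerates.image_mkQ {W : Type*} [AddCommGroup W] [Module ℂ W]
    {V : VertexSuperalgebra W} {I : Submodule ℂ W} (hI : V.IsIdeal I) {X Y : Set W}
    (hX : V.StronglyGenerates X) (hXY : ∀ x ∈ X, x ∉ I → x ∈ Y) :
    (V.quotient hI).StronglyGenerates (I.mkQ '' Y) := by
  rw [VertexSuperalgebra.StronglyGenerates, eq_top_iff, ← Submodule.range_mkQ I,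
    LinearMap.range_eq_map, ← hX, Submodule.map_span, Submodule.span_le]
  rintro _ ⟨_, ⟨l, hl, rfl⟩, rfl⟩
  induction l with
  | nil => exact Submodule.subset_span ⟨[], by simp, rfl⟩
  | cons x l ih =>
    have ih := ih fun x hx => hl x (List.mem_cons_of_mem _ hx)
    obtain ⟨k, x⟩ := x
    have hx := hl (k, x) List.mem_cons_self
    change I.mkQ (V.nprod (-1) ((V.T ^ k) x) (V.monomial l)) ∈ _
    have hk : I.mkQ (V.nprod (-1) ((V.T ^ k) x) (V.monomial l)) = (V.quotient hI).nprod (-1)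
        (((V.quotient hI).T ^ k) (I.mkQ x)) (I.mkQ (V.monomial l)) := by
      rw [V.nprod_T_pow, (V.quotient hI).nprod_T_pow, map_smul]
      rfl
    rw [hk]
    by_cases hxI : x ∈ I
    · have : I.mkQ x = 0 := (Submodule.Quotient.mk_eq_zero I).2 hxI
      simp [this]
    · rw [SetLike.mem_coe] at ih
      generalize I.mkQ (V.monomial l) = w at ih
      induction ih using Submodule.span_induction with
      | mem w h =>
        obtain ⟨l', hl', rfl⟩ := h
        refine Submodule.subset_span ⟨(k, I.mkQ x) :: l', ?_, rfl⟩
        rintro y hy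
        obtain rfl | hy := List.mem_cons.1 hy
        · exact ⟨x, hXY x hx hxI, rfl⟩
        · exact hl' y hy
      | zero => simp
      | add x y _ _ hx hy => simpa using add_mem hx hy
      | smul c x _ hx => simpa using Submodule.smul_mem _ c hx

namespace ConformalVertexAlgebra

variable {W : Type*} [AddCommGroup W] [Module ℂ W] (V : ConformalVertexAlgebra W)

theorem mem_weightSpace {d : ℂ} {w : W} : w ∈ V.weightSpace d ↔ V.nprod 1 V.L w = d • w :=
  Module.End.mem_eigenspace_iff

/-- The grading by half-integral conformal weights. -/
def weightGrading (n : ℤ) : Submodule ℂ W := V.weightSpace ((n : ℂ) / 2)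

theorem weightGrading_two : V.weightGrading 2 = V.weightSpace 1 := by
  simp [weightGrading]

theorem injective_intCast_div_two : Function.Injective fun n : ℤ => (n : ℂ) / 2 := by
  intro m n h
  exact_mod_cast (div_left_inj' (two_ne_zero' ℂ)).1 h

/-- The eigenspaces at `n / 2` already fill `W`, leaving no room for an independent one. -/
theorem exists_nat_of_weightSpace_ne_bot {d : ℂ} (h : V.weightSpace d ≠ ⊥) :
    ∃ n : ℕ, d = (n : ℂ) / 2 := by
  by_contra! hd
  refine h ?_
  have hi := (Module.End.eigenspaces_iSupIndep (V.nprod 1 V.L)) d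
  have htop : ⨆ (e : ℂ) (_ : e ≠ d), Module.End.eigenspace (V.nprod 1 V.L) e = ⊤ := by
    rw [eq_top_iff, ← V.iSup_eigenspace]
    exact iSup_le fun n => le_iSup₂_of_le ((n : ℂ) / 2) (hd n).symm le_rfl
  rw [htop] at hi
  exact disjoint_top.1 hi

theorem isWeightGrading : V.IsWeightGrading V.weightGrading where
  indep := (Module.End.eigenspaces_iSupIndep (V.nprod 1 V.L)).comp injective_intCast_div_two
  iSup_eq_top := by
    rw [eq_top_iff, ← V.iSup_eigenspace]
    exact iSup_le fun n => le_iSup_of_le (n : ℤ) (by simp [weightGrading, weightSpace])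
  eq_bot_of_neg n hn := by
    by_contra h
    obtain ⟨m, hm⟩ := V.exists_nat_of_weightSpace_ne_bot h
    have := injective_intCast_div_two (a₁ := n) (a₂ := m) (by simpa using hm)
    omega
  zero_le := by
    rw [← V.eigenspace_zero]
    simp [weightGrading, weightSpace]
  vac_mem := by
    rw [weightGrading, mem_weightSpace, V.nprod_vac_of_nonneg _ 1 zero_le_one]
    simp
  nprod_mem k m n a b ha hb := by
    rw [weightGrading, mem_weightSpace] at ha hb ⊢
    -- With `L(-1) = T`, the commutator of `L(0)` and `a_k` is `(m / 2 - k - 1) a_k`.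
    rw [V.one_mode_commutator V.L_even, ha, hb, V.L_neg_one, ← V.T_apply, V.nprod_T,
      add_sub_cancel_right, map_smul, map_smul, LinearMap.smul_apply, ← add_smul, ← add_smul]
    congr 1
    push_cast
    ring

theorem isGraded_eigenspace {f : Module.End ℂ W} (hf : ∀ p, ∀ x ∈ V.par p, f x ∈ V.par p) (d : ℂ) :
    V.IsGraded (Module.End.eigenspace f d) := by
  intro x hx y hy hxy
  rw [Module.End.mem_eigenspace_iff] at hxy ⊢
  rw [Module.End.mem_eigenspace_iff]
  rw [map_add, smul_add] at hxy
  have h : f x - d • x = d • y - f y := by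
    rw [sub_eq_sub_iff_add_eq_add, hxy, add_comm]
  have h0 : f x - d • x = 0 := Submodule.disjoint_def.1 V.par_isCompl.disjoint _
    (sub_mem (hf _ _ hx) (Submodule.smul_mem _ _ hx))
    (h ▸ sub_mem (Submodule.smul_mem _ _ hy) (hf _ _ hy))
  exact ⟨sub_eq_zero.1 h0, (sub_eq_zero.1 (h ▸ h0 : d • y - f y = 0)).symm⟩

theorem isGraded_weightSpace (d : ℂ) : V.IsGraded (V.weightSpace d) :=
  V.isGraded_eigenspace (fun p x hx => by simpa using V.nprod_mem 1 V.L_even hx) d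

theorem IsGraded.inf {V : VertexSuperalgebra W} {M N : Submodule ℂ W} (hM : V.IsGraded M)
    (hN : V.IsGraded N) : V.IsGraded (M ⊓ N) := fun x hx y hy h =>
  ⟨⟨(hM x hx y hy h.1).1, (hN x hx y hy h.2).1⟩, ⟨(hM x hx y hy h.1).2, (hN x hx y hy h.2).2⟩⟩

variable {V}

/-- Schur's lemma. -/
theorem IsIrreducible.exists_scalar {S : Submodule ℂ W} (hS : V.IsIrreducible S) {d : ℂ}
    (hSd : S ≤ V.weightSpace d) {f : Module.End ℂ W}
    (hpar : ∀ p, ∀ x ∈ V.par p, f x ∈ V.par p) (hfS : ∀ v ∈ S, f v ∈ S)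
    (hcomm : ∀ a ∈ V.weightSpace 1, ∀ v ∈ S, f (V.nprod 0 a v) = V.nprod 0 a (f v)) :
    ∃ c : ℂ, ∀ v ∈ S, f v = c • v := by
  obtain ⟨n, rfl⟩ := V.exists_nat_of_weightSpace_ne_bot
    (fun h => hS.ne_bot (le_bot_iff.1 (h ▸ hSd)))
  have : FiniteDimensional ℂ (V.weightSpace ((n : ℂ) / 2)) := V.finite_eigenspace n
  have : FiniteDimensional ℂ S := Submodule.finiteDimensional_of_le hSd
  have : Nontrivial S := (Submodule.nontrivial_iff_ne_bot).2 hS.ne_bot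
  obtain ⟨c, hc⟩ := Module.End.exists_eigenvalue (f.restrict hfS)
  obtain ⟨v, hv⟩ := hc.exists_hasEigenvector
  refine ⟨c, ?_⟩
  -- Irreducibility only concerns graded submodules; the eigenspace is graded because `f` preserves
  -- parity.
  obtain h | h := hS.eq_bot_or_eq (S ⊓ Module.End.eigenspace f c) inf_le_left
    (IsGraded.inf hS.graded (V.isGraded_eigenspace hpar c)) fun a ha w hw =>
    ⟨hS.stable a ha w hw.1, by
      rw [SetLike.mem_coe, Module.End.mem_eigenspace_iff, hcomm a ha w hw.1,
        Module.End.mem_eigenspace_iff.1 hw.2, map_smul]⟩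
  · refine absurd (Subtype.ext ?_) hv.2
    have : (v : W) ∈ S ⊓ Module.End.eigenspace f c :=
      ⟨v.2, Module.End.mem_eigenspace_iff.2 (congrArg Subtype.val hv.apply_eq_smul)⟩
    rw [h] at this
    exact (Submodule.mem_bot ℂ).1 this
  · intro w hw
    rw [← h] at hw
    exact Module.End.mem_eigenspace_iff.1 hw.2

namespace AffineDecomposition

variable {r : ℕ} (D : V.AffineDecomposition r)

theorem comp_le (i : Fin (r + 1)) : D.comp i ≤ V.weightSpace 1 :=
  D.iSup_comp ▸ le_iSup D.comp i

theorem comp_le_weightGrading (i : Fin (r + 1)) : D.comp i ≤ V.weightGrading 2 :=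
  V.weightGrading_two ▸ D.comp_le i

theorem isGraded_comp (i : Fin (r + 1)) : V.IsGraded (D.comp i) := by
  induction i using Fin.cases with
  | zero =>
    intro x hx y hy h
    have hy0 : y ∈ V.par 0 := by
      have := sub_mem (D.zero_even h) hx
      rwa [add_sub_cancel_left] at this
    obtain rfl : y = 0 := Submodule.disjoint_def.1 V.par_isCompl.disjoint y hy0 hy
    exact ⟨by simpa using h, zero_mem _⟩
  | succ i => exact (D.basic i).graded

/-- The parities of the elements of the chosen basis of `𝔞ᵢ`. -/
def basisParity (i : Fin r) (m : Fin (D.dim i)) : ZMod 2 := (D.basis_homogeneous i m).choose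

theorem basis_mem_par (i : Fin r) (m : Fin (D.dim i)) :
    (D.basis i m : W) ∈ V.par (D.basisParity i m) := (D.basis_homogeneous i m).choose_spec

theorem dual_mem_par (i : Fin r) (m : Fin (D.dim i)) :
    (D.dual i m : W) ∈ V.par (D.basisParity i m) :=
  (D.form_invariant i).dualBasis_mem_par (D.basic i).graded (D.form_nondeg i) (D.basis i)
    (D.basis_mem_par i) m

theorem casimir_apply (i : Fin r) (w : W) :
    D.casimir i w = ∑ m, V.nprod 0 (D.basis i m : W) (V.nprod 0 (D.dual i m : W) w) := by
  simp [casimir, LinearMap.sum_apply]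

theorem casimir₀_apply (w : W) :
    D.casimir₀ w = ∑ m ∈ D.nondeg, V.nprod 0 (D.basis₀ m : W) (V.nprod 0 (D.basis₀ m : W) w) := by
  simp [casimir₀, LinearMap.sum_apply]

theorem casimir_mem_par (i : Fin r) (p : ZMod 2) (w : W) (hw : w ∈ V.par p) :
    D.casimir i w ∈ V.par p := by
  rw [casimir_apply]
  refine sum_mem fun m _ => ?_
  have := V.nprod_mem 0 (D.basis_mem_par i m) (V.nprod_mem 0 (D.dual_mem_par i m) hw)
  rwa [← add_assoc, CharTwo.add_self_eq_zero, zero_add] at this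

theorem casimir₀_mem_par (p : ZMod 2) (w : W) (hw : w ∈ V.par p) : D.casimir₀ w ∈ V.par p := by
  rw [casimir₀_apply]
  refine sum_mem fun m _ => ?_
  have h := D.zero_even (D.basis₀ m).2
  simpa using V.nprod_mem 0 h (V.nprod_mem 0 h hw)

/-- An operator commuting with the action of the homogeneous elements of all components commutes
with the action of `W(1)`. -/
theorem comm_of_forall_comp {f : Module.End ℂ W}
    (h : ∀ i, ∀ a ∈ D.comp i, ∀ p, a ∈ V.par p → ∀ w, f (V.nprod 0 a w) = V.nprod 0 a (f w))
    {a : W} (ha : a ∈ V.weightSpace 1) (w : W) : f (V.nprod 0 a w) = V.nprod 0 a (f w) := by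
  rw [← D.iSup_comp] at ha
  induction ha using Submodule.iSup_induction' with
  | mem i a ha =>
    obtain ⟨x, hx, y, hy, rfl⟩ := V.exists_parity a
    obtain ⟨hxi, hyi⟩ := D.isGraded_comp i x hx y hy ha
    simp only [map_add, LinearMap.add_apply, h i x hxi 0 hx w, h i y hyi 1 hy w]
  | zero => simp
  | add x y _ _ hx hy => simp only [map_add, LinearMap.add_apply, hx, hy]

theorem casimir_comm (i : Fin r) {a : W} (ha : a ∈ V.weightSpace 1) (w : W) :
    D.casimir i (V.nprod 0 a w) = V.nprod 0 a (D.casimir i w) := by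
  refine D.comm_of_forall_comp (fun k a ha p hap w => ?_) ha w
  rw [casimir_apply, casimir_apply]
  obtain rfl | hk := eq_or_ne k i.succ
  · exact ((D.form_invariant i).casimir_comm (D.basic i).graded (D.basic i).bracket_mem
      V.isWeightGrading (D.comp_le_weightGrading _) (D.form_nondeg i) (D.basis i)
      (D.basis_mem_par i) hap ha w).symm
  · rw [map_sum]
    refine Finset.sum_congr rfl fun m _ => ?_
    rw [V.zero_mode_commutator hap (D.basis_mem_par i m),
      V.zero_mode_commutator hap (D.dual_mem_par i m), D.commute _ _ hk _ ha _ (D.basis i m).2,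
      D.commute _ _ hk _ ha _ (D.dual i m).2]
    simp [smul_smul]

theorem casimir₀_comm {a : W} (ha : a ∈ V.weightSpace 1) (w : W) :
    D.casimir₀ (V.nprod 0 a w) = V.nprod 0 a (D.casimir₀ w) := by
  refine D.comm_of_forall_comp (fun k a ha p hap w => ?_) ha w
  rw [casimir₀_apply, casimir₀_apply, map_sum]
  refine Finset.sum_congr rfl fun m _ => ?_
  have h0 : V.nprod 0 a (D.basis₀ m) = 0 := by
    obtain rfl | hk := eq_or_ne k 0
    · exact D.zero_abelian _ ha _ (D.basis₀ m).2
    · exact D.commute _ _ hk _ ha _ (D.basis₀ m).2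
  have hb := D.zero_even (D.basis₀ m).2
  rw [V.zero_mode_commutator hap hb, V.zero_mode_commutator hap hb, h0]
  simp

theorem casimir_apply_eq_smul {S : Submodule ℂ W} (hS : V.IsIrreducible S)
    {d : ℂ} (hSd : S ≤ V.weightSpace d) (i : Fin r) {w : W} (hw : w ∈ S) :
    D.casimir i w = scalarOn (D.casimir i) S • w :=
  apply_eq_scalarOn_smul (hS.exists_scalar hSd (D.casimir_mem_par i) (fun v hv => by
    rw [casimir_apply]
    exact sum_mem fun m _ => hS.stable _ (D.comp_le _ (D.basis i m).2) _
      (hS.stable _ (D.comp_le _ (D.dual i m).2) _ hv))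
    fun a ha v _ => D.casimir_comm i ha v) hw

theorem casimir₀_apply_eq_smul {S : Submodule ℂ W} (hS : V.IsIrreducible S)
    {d : ℂ} (hSd : S ≤ V.weightSpace d) {w : W} (hw : w ∈ S) :
    D.casimir₀ w = scalarOn D.casimir₀ S • w :=
  apply_eq_scalarOn_smul (hS.exists_scalar hSd D.casimir₀_mem_par (fun v hv => by
    rw [casimir₀_apply]
    exact sum_mem fun m _ => hS.stable _ (D.comp_le _ (D.basis₀ m).2) _
      (hS.stable _ (D.comp_le _ (D.basis₀ m).2) _ hv))
    fun a ha v _ => D.casimir₀_comm ha v) hw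

theorem nprod_one_sugawara_sub_mem {n : ℤ} {w : W} (hw : w ∈ V.weightGrading n) :
    V.nprod 1 D.sugawara w - ((1 / 2 : ℂ) • D.casimir₀ w +
      ∑ i, (1 / (2 * (D.level i + D.dualCoxeter i))) • D.casimir i w) ∈
      V.currentDescendants V.weightGrading n := by
  have h0 : ∀ m, V.nprod 1 (V.nprod (-1) (D.basis₀ m : W) (D.basis₀ m)) w -
      V.nprod 0 (D.basis₀ m : W) (V.nprod 0 (D.basis₀ m : W) w) ∈
      V.currentDescendants V.weightGrading n := fun m => by
    have hb := D.zero_even (D.basis₀ m).2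
    have hb2 := D.comp_le_weightGrading _ (D.basis₀ m).2
    simpa using V.isWeightGrading.normal_product_zero_mode_mem hb hb hb2 hb2 hw
  have h1 : ∀ i, V.nprod 1 (∑ m, V.nprod (-1) (D.basis i m : W) (D.dual i m)) w -
      D.casimir i w ∈ V.currentDescendants V.weightGrading n := fun i => by
    let f : D.comp i.succ →ₗ[ℂ] D.comp i.succ →ₗ[ℂ] W :=
      LinearMap.mk₂ ℂ (fun x y => V.nprod 0 (x : W) (V.nprod 0 (y : W) w))
        (by simp) (by simp) (by simp) (by simp)
    -- The zero modes of `:xᵐ xₘ:` come out in the order `xₘ xᵐ` with a sign. Supersymmetry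
    -- identifies the signed sum with the Casimir element.
    have hf : D.casimir i w = ∑ m, parSign (D.basisParity i m) (D.basisParity i m) •
        V.nprod 0 (D.dual i m : W) (V.nprod 0 (D.basis i m : W) w) := by
      rw [casimir_apply]
      exact ((D.form_invariant i).sum_basis_dualBasis (D.form_nondeg i) (D.basis i)
        (D.basis_mem_par i) f).symm
    rw [hf, map_sum, LinearMap.sum_apply, ← Finset.sum_sub_distrib]
    exact sum_mem fun m _ => V.isWeightGrading.normal_product_zero_mode_mem (D.basis_mem_par i m)
      (D.dual_mem_par i m) (D.comp_le_weightGrading _ (D.basis i m).2)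
      (D.comp_le_weightGrading _ (D.dual i m).2) hw
  rw [sugawara, map_add, LinearMap.add_apply, map_smul, LinearMap.smul_apply, map_sum, map_sum,
    LinearMap.sum_apply, LinearMap.sum_apply, add_sub_add_comm, ← smul_sub, casimir₀_apply,
    ← Finset.sum_sub_distrib, ← Finset.sum_sub_distrib]
  refine add_mem (Submodule.smul_mem _ _ (sum_mem fun m _ => h0 m)) (sum_mem fun i _ => ?_)
  rw [map_smul, LinearMap.smul_apply, ← smul_sub]
  exact Submodule.smul_mem _ _ (h1 i)

theorem casimirWeight_smul {S : Submodule ℂ W} (hS : V.IsIrreducible S) {d : ℂ}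
    (hSd : S ≤ V.weightSpace d) {w : W} (hw : w ∈ S) :
    D.casimirWeight S • w = (1 / 2 : ℂ) • D.casimir₀ w +
      ∑ i, (1 / (2 * (D.level i + D.dualCoxeter i))) • D.casimir i w := by
  rw [casimirWeight, add_comm, add_smul, Finset.sum_smul]
  congr 1
  · obtain h | h : (∀ x ∈ D.comp 0, ∀ y ∈ D.comp 0, V.nprod 1 x y = 0) ∨ D.level₀ = 1 := by
      by_cases h : ∀ x ∈ D.comp 0, ∀ y ∈ D.comp 0, V.nprod 1 x y = 0
      · exact .inl h
      · exact .inr (if_neg h)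
    · have hvac : V.vac ≠ 0 := by
        intro h0
        refine hS.ne_bot ((Submodule.eq_bot_iff _).2 fun v _ => ?_)
        have := V.vac_nprod (-1) v
        rw [h0] at this
        simpa using this.symm
      -- When the form vanishes on `𝔞₀`, the convention that the last summand is zero agrees with an
      -- empty Casimir sum.
      have hne : D.nondeg = ∅ := Finset.eq_empty_of_forall_notMem fun m hm => hvac <| by
        have := D.basis₀_form m m
        rw [if_pos ⟨rfl, hm⟩, h _ (D.basis₀ m).2 _ (D.basis₀ m).2] at this
        exact this.symm
      have hl : D.level₀ = 0 := if_pos h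
      simp [hl, casimir₀_apply, hne]
    · rw [h, if_neg one_ne_zero, D.casimir₀_apply_eq_smul hS hSd hw, smul_smul]
      congr 1
      ring
  · refine Finset.sum_congr rfl fun i _ => ?_
    rw [D.casimir_apply_eq_smul hS hSd i hw, smul_smul]
    congr 1
    ring

theorem sub_sugawara_mem_ideal : V.L - D.sugawara ∈ D.ideal := by
  simp only [ideal, VertexSuperalgebra.idealSpan, Submodule.mem_sInf]
  exact fun I hI => hI.2 rfl

/-- In the quotient by `L - L^𝔞`, a module `S` on which the conformal weight differs from
the Casimir weight is spanned by descendants of vectors of smaller weight. -/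
theorem mkQ_mem_map_currentDescendants {S : Submodule ℂ W} (hS : V.IsIrreducible S) {n : ℤ}
    (hSn : S ≤ V.weightGrading n) (hne : D.casimirWeight S ≠ (n : ℂ) / 2) {w : W} (hw : w ∈ S) :
    D.ideal.mkQ w ∈ (V.currentDescendants V.weightGrading n).map D.ideal.mkQ := by
  have h1 := D.nprod_one_sugawara_sub_mem (hSn hw)
  rw [← D.casimirWeight_smul hS hSn hw] at h1
  have h2 : V.nprod 1 D.sugawara w - ((n : ℂ) / 2) • w ∈ D.ideal := by
    have := D.isIdeal_ideal.right 1 w _ D.sub_sugawara_mem_ideal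
    rw [map_sub, LinearMap.sub_apply, V.mem_weightSpace.1 (hSn hw)] at this
    simpa using neg_mem this
  have h3 : D.ideal.mkQ (V.nprod 1 D.sugawara w) = ((n : ℂ) / 2) • D.ideal.mkQ w := by
    rw [← map_smul]
    exact (Submodule.Quotient.eq _).2 h2
  have h4 := Submodule.mem_map_of_mem (f := D.ideal.mkQ) h1
  rw [map_sub, h3, map_smul, ← sub_smul] at h4
  exact (Submodule.smul_mem_iff _ (sub_ne_zero.2 hne.symm)).1 h4

/-! ### Weights and strong generators of `W / I`. -/

/-- The grading of `W / I` by conformal weights. -/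
def quotientGrading (n : ℤ) : Submodule ℂ (W ⧸ D.ideal) := (V.weightGrading n).map D.ideal.mkQ

theorem isWeightGrading_quotient : D.quotient.IsWeightGrading D.quotientGrading :=
  V.isWeightGrading.quotient D.isIdeal_ideal <| by
    -- Images of weight spaces lie in distinct eigenspaces of the induced `L(0)`, which makes them
    -- independent.
    refine ((Module.End.eigenspaces_iSupIndep (D.quotient.nprod 1 (D.ideal.mkQ V.L))).comp
      injective_intCast_div_two).mono ?_
    rintro n _ ⟨w, hw, rfl⟩
    refine Module.End.mem_eigenspace_iff.2 ?_
    rw [← map_smul, ← V.mem_weightSpace.1 hw]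
    rfl

theorem map_currentDescendants_le {A : Set (W ⧸ D.ideal)}
    (hA : D.ideal.mkQ '' (V.weightSpace 1 : Set W) ⊆ A) {n : ℤ}
    (h : ∀ e < n, D.quotientGrading e ≤ D.quotient.monomialSpan D.quotientGrading A e) :
    (V.currentDescendants V.weightGrading n).map D.ideal.mkQ ≤
      D.quotient.monomialSpan D.quotientGrading A n := by
  rw [Submodule.map_le_iff_le_comap, VertexSuperalgebra.currentDescendants, Submodule.span_le]
  rintro _ ⟨k, p, a, ha, hap, v, hv, rfl⟩
  have := VertexSuperalgebra.nprod_mem_monomialSpan (V := D.quotient) (G := D.quotientGrading)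
    (A := A) (x := D.ideal.mkQ a) (m := 2) k (hA ⟨a, V.weightGrading_two ▸ ha, rfl⟩)
    (⟨a, hap, rfl⟩ : _ ∈ D.quotient.par p) ⟨a, ha, rfl⟩ (h (n - 2 * k - 2) (by omega) ⟨v, hv, rfl⟩)
  rwa [show 2 + 2 * (k : ℤ) + (n - 2 * k - 2) = n by ring] at this

theorem isHomogeneousSet_generators {J : Type*} {S : J → Submodule ℂ W} {Δ : J → ℂ}
    (hS : ∀ i, V.IsIrreducible (S i)) (hSΔ : ∀ i, S i ≤ V.weightSpace (Δ i)) (K : Set J) :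
    D.quotient.IsHomogeneousSet D.quotientGrading
      (D.ideal.mkQ '' ((V.weightSpace 1 : Set W) ∪ ⋃ i ∈ K, (S i : Set W))) := by
  refine VertexSuperalgebra.isHomogeneousSet_image_mkQ D.isIdeal_ideal ?_
  rintro x (hx | hx)
  · exact ⟨_, hx, Set.subset_union_left, V.isGraded_weightSpace 1, 2, V.weightGrading_two.ge⟩
  · simp only [Set.mem_iUnion] at hx
    obtain ⟨i, hi, hx⟩ := hx
    obtain ⟨n, hn⟩ := V.exists_nat_of_weightSpace_ne_bot
      (fun h => (hS i).ne_bot (le_bot_iff.1 (h ▸ hSΔ i)))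
    refine ⟨_, hx, ?_, (hS i).graded, n, ?_⟩
    · exact Set.subset_union_of_subset_right
        (Set.subset_biUnion_of_mem (u := fun i => (S i : Set W)) hi) _
    · simpa [weightGrading, ← hn] using hSΔ i

/-- Modules `S i` whose Casimir weight differs from the conformal weight may be omitted from a
set of strong generators of `W / I`. -/
theorem QuotientGeneratedBy.of_casimirWeight_ne {J : Type*} {S : J → Submodule ℂ W} {Δ : J → ℂ}
    (hS : ∀ i, V.IsIrreducible (S i)) (hSΔ : ∀ i, S i ≤ V.weightSpace (Δ i)) {K K' : Set J}
    (hK : D.QuotientGeneratedBy S K)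
    (h : ∀ i ∈ K, i ∉ K' → D.casimirWeight (S i) ≠ Δ i) : D.QuotientGeneratedBy S K' := by
  set A := D.ideal.mkQ '' ((V.weightSpace 1 : Set W) ∪ ⋃ i ∈ K', (S i : Set W)) with hA
  have hG := D.isWeightGrading_quotient
  refine VertexSuperalgebra.StronglyGenerates.of_forall_mem_monomialSpan hG hK
    (D.isHomogeneousSet_generators hS hSΔ K) (D.isHomogeneousSet_generators hS hSΔ K') ?_
  rintro _ ⟨x, hx, rfl⟩ p hp m hm hlt
  by_cases hxA : D.ideal.mkQ x ∈ A
  · have := VertexSuperalgebra.nprod_mem_monomialSpan (V := D.quotient) 0 hxA hp hm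
      VertexSuperalgebra.vac_mem_monomialSpan
    simpa [D.quotient.nprod_vac] using this
  obtain hx | hx := hx
  · exact absurd ⟨x, .inl hx, rfl⟩ hxA
  simp only [Set.mem_iUnion] at hx
  obtain ⟨i, hi, hx⟩ := hx
  have hi' : i ∉ K' := fun hi' => hxA ⟨x, .inr (Set.mem_biUnion hi' hx), rfl⟩
  obtain ⟨n, hn⟩ := V.exists_nat_of_weightSpace_ne_bot
    (fun h => (hS i).ne_bot (le_bot_iff.1 (h ▸ hSΔ i)))
  have hSn : S i ≤ V.weightGrading n := by simpa [weightGrading, ← hn] using hSΔ i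
  -- The weight `m` is that of the image of `x`; it agrees with the weight `n` of `S i` unless that
  -- image is zero.
  obtain rfl | h0 := hG.eq_or_eq_zero hm ⟨x, hSn hx, rfl⟩
  · refine D.map_currentDescendants_le ?_ hlt (D.mkQ_mem_map_currentDescendants (hS i) hSn ?_ hx)
    · exact Set.image_mono Set.subset_union_left
    · simpa [← hn] using h i hi hi'
  · rw [h0]
    exact zero_mem _

/-- `W / I` is strongly generated by the images of `W(1)` and all of the `S i`. -/
theorem quotientGeneratedBy_univ {J : Type*} {S : J → Submodule ℂ W} (h : V.StronglyGenerates
    ((V.weightSpace 1 : Set W) ∪ {V.L - D.sugawara} ∪ ⋃ i, (S i : Set W))) :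
    D.QuotientGeneratedBy S Set.univ := by
  refine VertexSuperalgebra.StronglyGenerates.image_mkQ D.isIdeal_ideal h ?_
  rintro x ((hx | hx) | hx) hx0
  · exact .inl hx
  · rw [Set.mem_singleton_iff.1 hx] at hx0
    exact absurd D.sub_sugawara_mem_ideal hx0
  · exact .inr (by simpa using hx)

theorem map_affineSubalgebra_eq_top {J : Type*} {S : J → Submodule ℂ W}
    (h : D.QuotientGeneratedBy S ∅) : V.affineSubalgebra.map D.ideal.mkQ = ⊤ := by
  rw [eq_top_iff, ← h, Submodule.span_le]
  rintro _ ⟨l, hl, rfl⟩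
  have hsub := V.isSubalgebra_affineSubalgebra
  have hmem : (V.weightSpace 1 : Set W) ⊆ V.affineSubalgebra := by
    intro x hx
    simp only [affineSubalgebra, VertexSuperalgebra.adjoin, SetLike.mem_coe, Submodule.mem_sInf]
    exact fun U hU => hU.2 hx
  induction l with
  | nil => exact ⟨_, hsub.vac_mem, rfl⟩
  | cons x l ih =>
    obtain ⟨w, hw, hwl⟩ := ih fun x hx => hl x (List.mem_cons_of_mem _ hx)
    obtain ⟨k, x⟩ := x
    obtain ⟨y, hy, rfl⟩ : ∃ y ∈ V.weightSpace 1, D.ideal.mkQ y = x := by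
      obtain ⟨y, hy, hyx⟩ := hl (k, x) List.mem_cons_self
      exact ⟨y, by simpa using hy, hyx⟩
    change D.quotient.nprod (-1) ((D.quotient.T ^ k) _) (D.quotient.monomial l) ∈ _
    rw [D.quotient.nprod_T_pow, ← hwl]
    exact Submodule.smul_mem _ _ ⟨_, hsub.nprod_mem (-1 - k) y (hmem hy) w hw, rfl⟩

/-- If `V(𝔞)` maps onto `W / I`, the natural map `V(𝔞) / (I ∩ V(𝔞)) → W / I` is an isomorphism. -/
theorem exists_isIso (h : V.affineSubalgebra.map D.ideal.mkQ = ⊤) :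
    ∃ e : (V.affineSubalgebra ⧸ D.ideal.comap V.affineSubalgebra.subtype) ≃ₗ[ℂ] (W ⧸ D.ideal),
      D.affineQuotient.IsIso D.quotient e ∧
      ∀ v : V.affineSubalgebra, e (Submodule.Quotient.mk v) = Submodule.Quotient.mk (v : W) := by
  let f := (D.ideal.comap V.affineSubalgebra.subtype).mapQ D.ideal V.affineSubalgebra.subtype le_rfl
  have hf : Function.Bijective f := by
    constructor
    · refine (injective_iff_map_eq_zero f).2 fun x hx => ?_
      obtain ⟨x, rfl⟩ := Submodule.mkQ_surjective _ x
      have hx0 : D.ideal.mkQ (x : W) = 0 := hx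
      exact (Submodule.Quotient.mk_eq_zero _).2 ((Submodule.Quotient.mk_eq_zero D.ideal).1 hx0)
    · intro y
      obtain ⟨w, hw, rfl⟩ : y ∈ V.affineSubalgebra.map D.ideal.mkQ := h ▸ Submodule.mem_top
      exact ⟨Submodule.Quotient.mk ⟨w, hw⟩, rfl⟩
  refine ⟨LinearEquiv.ofBijective f hf, ⟨?_, rfl, ?_⟩, fun v => rfl⟩
  · rintro p _ ⟨a, ha, rfl⟩
    exact ⟨a, ha, rfl⟩
  · intro n a b
    obtain ⟨a, rfl⟩ := Submodule.mkQ_surjective _ a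
    obtain ⟨b, rfl⟩ := Submodule.mkQ_surjective _ b
    rfl

end AffineDecomposition

end ConformalVertexAlgebra
end

theorem theorem3p2 {W : Type*} [AddCommGroup W] [Module ℂ W] (V : ConformalVertexAlgebra W)
    (hφ : ∃ φ : W →ₛₗ[starRingEnd ℂ] W, V.IsConjInvolution φ ∧ φ V.L = V.L)
    (hhalf : V.weightSpace (1 / 2) = ⊥)
    (hprimary : ∀ a ∈ V.weightSpace 1, V.IsPrimary a)
    {r : ℕ} (D : V.AffineDecomposition r)
    (hnoncritical : ∀ i, D.level i + D.dualCoxeter i ≠ 0)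
    {J : Type*} (S : J → Submodule ℂ W) (Δ : J → ℂ)
    (hS_indep : iSupIndep S)
    (hS_irreducible : ∀ i, V.IsIrreducible (S i))
    (hS_weight : ∀ i, S i ≤ V.weightSpace (Δ i))
    (hS_generate : V.StronglyGenerates
      ((V.weightSpace 1 : Set W) ∪ {V.L - D.sugawara} ∪ ⋃ i, (S i : Set W)))
    (hS_two : ∀ X ∈ (⨆ i, S i) ⊓ V.weightSpace 2, V.nprod 3 (V.L - D.sugawara) X = 0)
    (hc : V.c = D.centralCharge) :
    (∀ K : Set J, Minimal (D.QuotientGeneratedBy S) K →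
      ∀ j ∈ K, D.casimirWeight (S j) = Δ j) ∧
    ((∀ i, D.casimirWeight (S i) ≠ Δ i) →
      (∀ K : Set J, Minimal (D.QuotientGeneratedBy S) K → K = ∅) ∧
      ∃ e : (V.affineSubalgebra ⧸ D.ideal.comap V.affineSubalgebra.subtype) ≃ₗ[ℂ]
          (W ⧸ D.ideal),
        D.affineQuotient.IsIso D.quotient e ∧
        ∀ v : V.affineSubalgebra, e (Submodule.Quotient.mk v) = Submodule.Quotient.mk (v : W)) := by
  have hne := fun {K K' : Set J} (hK : D.QuotientGeneratedBy S K) =>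
    ConformalVertexAlgebra.AffineDecomposition.QuotientGeneratedBy.of_casimirWeight_ne D
      hS_irreducible hS_weight (K' := K') hK
  have hempty : (∀ i, D.casimirWeight (S i) ≠ Δ i) → D.QuotientGeneratedBy S ∅ := fun h =>
    hne (D.quotientGeneratedBy_univ hS_generate) fun i _ _ => h i
  refine ⟨fun K hK j hj => ?_, fun h => ⟨fun K hK => ?_, ?_⟩⟩
  · by_contra hj'
    -- Dropping only `S j` preserves generation, against the minimality of `K`.
    have hgen : D.QuotientGeneratedBy S (K \ {j}) := hne hK.1 fun i hi hi' => by
      obtain rfl : i = j := by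
        by_contra hij
        exact hi' ⟨hi, hij⟩
      exact hj'
    exact (hK.2 hgen Set.sdiff_subset hj).2 rfl
  · exact Set.subset_eq_empty (hK.2 (hempty h) (Set.empty_subset _)) rfl
  · exact D.exists_isIso (D.map_affineSubalgebra_eq_top (hempty h))
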